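/- Let $q\ge 2$ and let $\mathfrak X$ be the homogeneous tree of degree $q+1$ (the tree in which every vertex has $q+1$ neighbours), with graph distance $d$, a fixed vertex $o$, $|x|=d(o,x)$, and the counting measure. Let $\Omega$ be the set of infinite geodesic rays starting at $o$, with the $\sigma$-algebra generated by the sets $E(x)$ of rays through $x$ ($x\in\mathfrak X$) and the probability measure $\nu$ determined by $\nu(E(x))=\frac{q}{(q+1)q^{|x|}}$ for $x\neq o$. For $\omega\in\Omega$ let $h_\omega(x)=2|c(x,\omega)|-|x|$, where $c(x,\omega)$ is the last point of $\omega$ on the geodesic path $[o,x]$. Let $\tau=\pi/\log q$ and let $d\mu(s)=c_P|c(s)|^{-2}\,ds$ on $[0,\tau]$ be the Plancherel measure, where $c(z)=\frac{q^{1/2}}{q+1}\,\frac{q^{1/2+iz}-q^{-1/2-iz}}{q^{iz}-q^{-iz}}$ and $c_P=\frac{q\log q}{2\pi(q+1)}$ (so that $\mu([0,\tau])=1$). For finitely supported $f$ let $\mathcal Hf(\omega,s)=\sum_y f(y)\,q^{(1/2+is)h_\omega(y)}$. For $\sigma:\mathfrak X\times\Omega\times[0,\tau]\to\mathbb C$ measurable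 and $f$ finitely supported let $$T_\sigma f(x)=\int_\Omega\int_0^\tau q^{(1/2-is)h_\omega(x)}\,\sigma(x,\omega,s)\,\mathcal Hf(\omega,s)\,d\nu(\omega)\,d\mu(s).$$ Let $1\le p_1,p_2<\infty$ and $1/p_1+1/p_1'=1$. We say that $T_\sigma:L^{p_1}(\mathfrak X)\to L^{p_2}(\mathfrak X)$ is nuclear if these integrals converge absolutely for all finitely supported $f$ and all $x$, and $T_\sigma$ coincides on the finitely supported functions with a nuclear operator $T:L^{p_1}(\mathfrak X)\to L^{p_2}(\mathfrak X)$, that is, a bounded operator of the form $Tu=\sum_k x_k'(u)\,y_k$ with $x_k'\in L^{p_1}(\mathfrak X)'$, $y_k\in L^{p_2}(\mathfrak X)$ and $\sum_k\|x_k'\|\,\|y_k\|<\infty$. Consider decompositions $$\sigma(x,\omega,s)=q^{-(1/2-is)h_\omega(x)}\sum_{k=1}^\infty f_k(x)\,\overline{\mathcal H\overline{g_k}(\omega,s)},\qquad g_k\in L^{p_1'}(\mathfrak X),\ f_k\in L^{p_2}(\mathfrak X),\ \sum_k\|g_k\|_{L^{p_1'}}\|f_k\|_{L^{p_2}}<\infty.\tag{$*$}$$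 1. If $p_1\ge2$, then $T_\sigma$ is nuclear if and only if there are sequences $(g_k),(f_k)$ such that for every $x$ the series in $(*)$ converges absolutely and $(*)$ holds for almost every $(\omega,s)$ with respect to $\nu\times\mu$; here $\mathcal H$ on $L^{p_1'}(\mathfrak X)\subset L^2(\mathfrak X)$ is the $L^2$-limit of the transforms of the restrictions to finite sets (the extension of $\mathcal H$ to an isometry on $L^2(\mathfrak X)$). 2. If $p_1>1$, then $T_\sigma$ is nuclear if and only if there are sequences $(g_k),(f_k)$ and integrable functions $\mathcal H\overline{g_k}$ on $\Omega\times[0,\tau]$ with $\overline{g_k(y)}=\int_\Omega\int_0^\tau q^{(1/2-is)h_\omega(y)}\mathcal H\overline{g_k}(\omega,s)\,d\nu\,d\mu$ for all $y$, such that for every $x$ one has $\sum_k|f_k(x)|\,\|\mathcal H\overline{g_k}\|_{L^1(\nu\times\mu)}<\infty$, the series in $(*)$ converges absolutely for almost every $(\omega,s)$, and $(*)$ holds for almost every $(\omega,s)$. For $p_1=1$ the existence of such a decomposition still implies that $T_\sigma$ is nuclear. 3. For all $p_1\ge1$, $T_\sigma$ is nuclear if and only if its integrals converge absolutely for all finitely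 supported functions and all $x$, and $(*)$ holds in the weak sense: there are sequences $(g_k),(f_k)$ as in $(*)$ such that for every $x$ and every finitely supported $\varphi$ $$\int_\Omega\int_0^\tau q^{(1/2-is)h_\omega(x)}\sigma(x,\omega,s)\,\mathcal H\varphi(\omega,s)\,d\nu\,d\mu=\sum_{k=1}^\infty f_k(x)\,\langle\mathcal H\varphi,\mathcal H\overline{g_k}\rangle,$$ with absolute convergence of the series, where, according to the Plancherel formula, $\langle\mathcal H\varphi,\mathcal Hg\rangle:=\sum_y\varphi(y)\overline{g(y)}$ for an arbitrary function $g$ on $\mathfrak X$. -/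

import Mathlib

open MeasureTheory Filter Topology
open scoped ENNReal ComplexConjugate

namespace HomogeneousTree

section Boundary

variable {V : Type*} (G : SimpleGraph V) (o : V)

/-- The boundary of the tree: the infinite geodesic rays starting at `o`. -/
structure Boundary where
  /-- the vertices of the ray -/
  ray : ℕ → V
  ray_zero : ray 0 = o
  dist_ray : ∀ n k : ℕ, G.dist (ray n) (ray (n + k)) = k

variable {G o}

/-- The set `E(x)` of the rays that pass through the vertex `x`. -/
def cylinder (G : SimpleGraph V) (o x : V) : Set (Boundary G o) :=
  {ω | ω.ray (G.dist o x) = x}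

/-- The σ-algebra on the boundary generated by the sets `E(x)`. -/
instance : MeasurableSpace (Boundary G o) :=
  MeasurableSpace.generateFrom (Set.range (cylinder G o))

open Classical in
/-- `|c(x, ω)|`, where the confluence point `c(x, ω)` is the last point of the ray `ω` that lies on
the geodesic path `[o, x]`. -/
noncomputable def confluence (ω : Boundary G o) (x : V) : ℕ :=
  Nat.findGreatest (fun n => G.dist o (ω.ray n) + G.dist (ω.ray n) x = G.dist o x) (G.dist o x)

/-- The height function `h_ω(x) = 2 |c(x, ω)| - |x|`. -/
noncomputable def height (ω : Boundary G o) (x : V) : ℤ :=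
  2 * (confluence ω x : ℤ) - (G.dist o x : ℤ)

/-- `ν` is the canonical measure on the boundary: a probability measure with
`ν (E(x)) = q / ((q + 1) q ^ |x|)` for every vertex `x ≠ o`. -/
def IsBoundaryMeasure (q : ℕ) (ν : Measure (Boundary G o)) : Prop :=
  IsProbabilityMeasure ν ∧
    ∀ x : V, x ≠ o → ν (cylinder G o x) = (q : ℝ≥0∞) / (((q : ℝ≥0∞) + 1) * (q : ℝ≥0∞) ^ G.dist o x)

/-- The neighbours of `v` that are farther from `o` than `v`. -/
abbrev Child (G : SimpleGraph V) (o v : V) : Type _ :=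
  {w : V // G.Adj v w ∧ G.dist o w = G.dist o v + 1}

theorem parent_unique (hG : G.IsTree) {u w v : V} (hu : G.Adj u v) (hw : G.Adj w v)
    (hdu : G.dist o v = G.dist o u + 1) (hdw : G.dist o v = G.dist o w + 1) : u = w := by
  obtain ⟨p, hp⟩ := hG.connected.exists_walk_length_eq_dist o u
  obtain ⟨r, hr⟩ := hG.connected.exists_walk_length_eq_dist o w
  have h1 : (p.concat hu).IsPath :=
    SimpleGraph.Walk.isPath_of_length_eq_dist _ (by simp [hp, hdu])
  have h2 : (r.concat hw).IsPath :=
    SimpleGraph.Walk.isPath_of_length_eq_dist _ (by simp [hr, hdw])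
  have h3 : p.concat hu = r.concat hw :=
    congrArg Subtype.val ((hG.isAcyclic.subsingleton_path o v).elim ⟨_, h1⟩ ⟨_, h2⟩)
  have h4 := congrArg SimpleGraph.Walk.penultimate h3
  simpa using h4

theorem exists_parent (hG : G.IsTree) {v : V} {n : ℕ} (hv : G.dist o v = n + 1) :
    ∃ u, G.Adj u v ∧ G.dist o u = n := by
  obtain ⟨p, hp⟩ := hG.connected.exists_walk_length_eq_dist o v
  have hnil : ¬ p.Nil := by
    intro h
    have := SimpleGraph.Walk.length_eq_zero_iff.2 h
    omega
  have hadj := p.adj_penultimate hnil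
  refine ⟨p.penultimate, hadj, ?_⟩
  have h1 : G.dist o p.penultimate ≤ n := by
    refine (SimpleGraph.dist_le p.dropLast).trans ?_
    simp [hp, hv]
  have h2 := hG.connected.dist_triangle (u := o) (v := p.penultimate) (w := v)
  have h3 := SimpleGraph.dist_eq_one_iff_adj.2 hadj
  omega

open Classical in
theorem card_child (hG : G.IsTree) {q : ℕ} (hreg : ∀ v, (G.neighborSet v).ncard = q + 1) (v : V) :
    Nat.card (Child G o v) = if v = o then q + 1 else q := by
  have hset : Nat.card (Child G o v) =
      {w : V | G.Adj v w ∧ G.dist o w = G.dist o v + 1}.ncard := rfl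
  rw [hset]
  split_ifs with h
  · subst h
    rw [← hreg v]
    congr 1
    ext w
    simp only [Set.mem_ofPred_eq, SimpleGraph.mem_neighborSet, SimpleGraph.dist_self]
    exact ⟨fun h => h.1, fun h => ⟨h, by simpa using SimpleGraph.dist_eq_one_iff_adj.2 h⟩⟩
  · have hpos : G.dist o v ≠ 0 := by
      rw [Ne, hG.connected.dist_eq_zero_iff]
      exact fun e => h e.symm
    obtain ⟨n, hn⟩ := Nat.exists_eq_succ_of_ne_zero hpos
    obtain ⟨u, hu, hun⟩ := exists_parent hG hn
    have hfin : (G.neighborSet v).Finite := Set.finite_of_ncard_ne_zero (by rw [hreg v]; omega)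
    have heq : {w : V | G.Adj v w ∧ G.dist o w = G.dist o v + 1} = G.neighborSet v \ {u} := by
      ext w
      simp only [Set.mem_ofPred_eq, Set.mem_sdiff, SimpleGraph.mem_neighborSet,
        Set.mem_singleton_iff]
      constructor
      · rintro ⟨h1, h2⟩
        refine ⟨h1, ?_⟩
        rintro rfl
        omega
      · rintro ⟨h1, h2⟩
        refine ⟨h1, ?_⟩
        rcases hG.dist_eq_dist_add_one_of_adj o h1 with h3 | h3
        · exact absurd (parent_unique hG h1.symm hu h3 (by omega)) h2
        · exact h3
    have := Set.ncard_sdiff_singleton_add_one (s := G.neighborSet v) (a := u) hu.symm hfin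
    rw [hreg v] at this
    rw [heq]
    omega

/-- The ray obtained from a choice of a child at every vertex. -/
def rayOf (c : ∀ v, Child G o v) : ℕ → V
  | 0 => o
  | n + 1 => (c (rayOf c n)).1

theorem dist_rayOf (c : ∀ v, Child G o v) (n : ℕ) : G.dist o (rayOf c n) = n := by
  induction n with
  | zero => simp [rayOf]
  | succ n ih => rw [rayOf, (c (rayOf c n)).2.2, ih]

theorem dist_rayOf_add (hG : G.IsTree) (c : ∀ v, Child G o v) (n k : ℕ) :
    G.dist (rayOf c n) (rayOf c (n + k)) = k := by
  apply le_antisymm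
  · induction k with
    | zero => simp
    | succ k ih =>
      have h1 := hG.connected.dist_triangle (u := rayOf c n) (v := rayOf c (n + k))
        (w := rayOf c (n + k + 1))
      have h2 : G.dist (rayOf c (n + k)) (rayOf c (n + k + 1)) = 1 :=
        SimpleGraph.dist_eq_one_iff_adj.2 (c (rayOf c (n + k))).2.1
      rw [← add_assoc]
      omega
  · have h1 := hG.connected.dist_triangle (u := o) (v := rayOf c n) (w := rayOf c (n + k))
    rw [dist_rayOf, dist_rayOf] at h1
    omega

/-- The canonical measure exists on the boundary of a homogeneous tree. -/
theorem exists_isBoundaryMeasure (hG : G.IsTree) {q : ℕ} (hq : 2 ≤ q)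
    (hreg : ∀ v, (G.neighborSet v).ncard = q + 1) :
    ∃ ν : Measure (Boundary G o), IsBoundaryMeasure q ν := by
  classical
  have hcard := card_child (o := o) hG hreg
  have hne : ∀ v, Nat.card (Child G o v) ≠ 0 := by
    intro v
    rw [hcard v]
    split_ifs <;> omega
  let _ : ∀ v, MeasurableSpace (Child G o v) := fun _ => ⊤
  have _ : ∀ v, Nonempty (Child G o v) := fun v => (Nat.card_ne_zero.1 (hne v)).1
  have _ : ∀ v, Finite (Child G o v) := fun v => (Nat.card_ne_zero.1 (hne v)).2
  let _ : ∀ v, Fintype (Child G o v) := fun v => Fintype.ofFinite _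
  let μ : ∀ v, Measure (Child G o v) := fun v => (PMF.uniformOfFintype (Child G o v)).toMeasure
  have hμ : ∀ v (a : Child G o v), μ v {a} = ((Nat.card (Child G o v) : ℕ) : ℝ≥0∞)⁻¹ := by
    intro v a
    simp only [μ]
    rw [PMF.toMeasure_apply_singleton _ _ (MeasurableSpace.measurableSet_top),
      PMF.uniformOfFintype_apply, Nat.card_eq_fintype_card]
  have _ : ∀ v, IsProbabilityMeasure (μ v) := fun v => by
    simp only [μ]
    infer_instance
  let Φ : (∀ v, Child G o v) → Boundary G o := fun c => ⟨rayOf c, rfl, dist_rayOf_add hG c⟩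
  have key : ∀ (n : ℕ) (x : V), G.dist o x = n →
      ∃ (s : Finset V) (t : ∀ v, Set (Child G o v)), (∀ v ∈ s, G.dist o v < n) ∧
        {c : ∀ v, Child G o v | rayOf c n = x} = Set.pi (s : Set V) t ∧
        ∏ v ∈ s, μ v (t v) = if n = 0 then 1 else
          (q : ℝ≥0∞) / (((q : ℝ≥0∞) + 1) * (q : ℝ≥0∞) ^ n) := by
    intro n
    induction n with
    | zero =>
      intro x hx
      refine ⟨∅, fun _ => Set.univ, by simp, ?_, by simp⟩
      have : o = x := (hG.connected.dist_eq_zero_iff).1 hx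
      ext c
      simp [rayOf, this]
    | succ n ih =>
      intro x hx
      obtain ⟨u, hu, hun⟩ := exists_parent hG hx
      obtain ⟨s, t, hs, hset, hprod⟩ := ih u hun
      have hus : u ∉ s := fun h => by
        have := hs u h
        omega
      let a : Child G o u := ⟨x, hu, by omega⟩
      refine ⟨insert u s, Function.update t u {a}, ?_, ?_, ?_⟩
      · intro v hv
        rcases Finset.mem_insert.1 hv with rfl | hv
        · omega
        · have := hs v hv
          omega
      · ext c
        have h1 : rayOf c (n + 1) = x ↔ rayOf c n = u ∧ c u = a := by
          constructor
          · intro h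
            have h2 : rayOf c n = u := by
              refine parent_unique (o := o) hG (v := x) ?_ hu ?_ (by omega)
              · rw [← h]
                exact (c (rayOf c n)).2.1
              · rw [dist_rayOf, hx]
            refine ⟨h2, Subtype.ext ?_⟩
            have h3 : ∀ v, v = u → (c v).1 = x → (c u).1 = x := by
              rintro _ rfl h
              exact h
            exact h3 _ h2 h
          · rintro ⟨h2, h3⟩
            rw [rayOf, h2, h3]
        have h4 : rayOf c n = u ↔ ∀ v ∈ s, c v ∈ t v := by
          have := Set.ext_iff.1 hset c
          simpa [Set.mem_pi] using this
        simp only [Set.mem_ofPred_eq, h1, h4, Finset.coe_insert, Set.mem_pi, Set.mem_insert_iff,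
          Finset.mem_coe]
        constructor
        · rintro ⟨h5, h6⟩ v (rfl | hv)
          · simp [h6]
          · rw [Function.update_of_ne (ne_of_mem_of_not_mem hv hus)]
            exact h5 v hv
        · intro h5
          refine ⟨fun v hv => ?_, ?_⟩
          · have := h5 v (Or.inr hv)
            rwa [Function.update_of_ne (ne_of_mem_of_not_mem hv hus)] at this
          · simpa using h5 u (Or.inl rfl)
      · rw [Finset.prod_insert hus, Function.update_self, hμ]
        have h6 : ∏ v ∈ s, μ v (Function.update t u {a} v) = ∏ v ∈ s, μ v (t v) := by
          refine Finset.prod_congr rfl fun v hv => ?_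
          rw [Function.update_of_ne (ne_of_mem_of_not_mem hv hus)]
        have hq0 : (q : ℝ≥0∞) ≠ 0 := by
          simp only [ne_eq, Nat.cast_eq_zero]
          omega
        have hqt : (q : ℝ≥0∞) ≠ ⊤ := ENNReal.natCast_ne_top q
        rw [h6, hprod, hcard]
        have huo : u = o ↔ n = 0 := by
          rw [← hun, hG.connected.dist_eq_zero_iff, eq_comm]
        simp only [huo, Nat.add_eq_zero_iff, one_ne_zero, and_false, if_false]
        split_ifs with hn
        · subst hn
          simp only [Nat.cast_add, Nat.cast_one, mul_one, zero_add, pow_one]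
          rw [ENNReal.div_eq_inv_mul, ENNReal.mul_inv (by simp) (Or.inr hq0), mul_assoc,
            ENNReal.inv_mul_cancel hq0 hqt, mul_one]
        · rw [pow_succ, ← mul_assoc, ENNReal.div_eq_inv_mul, ENNReal.div_eq_inv_mul,
            ENNReal.mul_inv (a := ((q : ℝ≥0∞) + 1) * (q : ℝ≥0∞) ^ n) (Or.inr hqt) (Or.inr hq0)]
          ring
  have hpre : ∀ x, Φ ⁻¹' cylinder G o x = {c | rayOf c (G.dist o x) = x} := fun x => rfl
  have hmeas_pi : ∀ (s : Finset V) (t : ∀ v, Set (Child G o v)),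
      MeasurableSet (Set.pi (s : Set V) t) := fun s t =>
    MeasurableSet.pi s.countable_toSet fun v _ => MeasurableSpace.measurableSet_top
  have hΦ : Measurable Φ := by
    refine measurable_generateFrom ?_
    rintro _ ⟨x, rfl⟩
    obtain ⟨s, t, -, hset, -⟩ := key _ x rfl
    rw [hpre, hset]
    exact hmeas_pi s t
  refine ⟨(Measure.infinitePi μ).map Φ, Measure.isProbabilityMeasure_map hΦ.aemeasurable, ?_⟩
  intro x hx
  obtain ⟨s, t, -, hset, hprod⟩ := key _ x rfl
  rw [Measure.map_apply hΦ (MeasurableSpace.measurableSet_generateFrom ⟨x, rfl⟩), hpre, hset,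
    Measure.infinitePi_pi μ (fun v _ => MeasurableSpace.measurableSet_top), hprod, if_neg]
  rw [hG.connected.dist_eq_zero_iff]
  exact fun h => hx h.symm

open Classical in
/-- The measure `ν` on the boundary of the homogeneous tree of degree `q + 1`. The generating sets
`E(x)` form, together with the empty set, a π-system, so that the two properties required by
`IsBoundaryMeasure` determine `ν`; by `exists_isBoundaryMeasure` there is such a measure. -/
noncomputable def boundaryMeasure (G : SimpleGraph V) (o : V) (q : ℕ) : Measure (Boundary G o) :=
  if h : ∃ ν : Measure (Boundary G o), IsBoundaryMeasure q ν then h.choose else 0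

theorem isBoundaryMeasure_boundaryMeasure (hG : G.IsTree) {q : ℕ} (hq : 2 ≤ q)
    (hreg : ∀ v, (G.neighborSet v).ncard = q + 1) :
    IsBoundaryMeasure q (boundaryMeasure G o q) := by
  have h := exists_isBoundaryMeasure (o := o) hG hq hreg
  rw [boundaryMeasure, dif_pos h]
  exact h.choose_spec

end Boundary

section Plancherel

/-- `τ = π / log q`. -/
noncomputable def tau (q : ℕ) : ℝ := Real.pi / Real.log q

/-- The interval `[0, τ]`. -/
abbrev Spectrum (q : ℕ) : Type := Set.Icc (0 : ℝ) (tau q)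

/-- The function `c(z) = (q^{1/2} / (q+1)) (q^{1/2+iz} - q^{-1/2-iz}) / (q^{iz} - q^{-iz})`. -/
noncomputable def cFunction (q : ℕ) (z : ℂ) : ℂ :=
  (q : ℂ) ^ (1 / 2 : ℂ) / ((q : ℂ) + 1) *
    (((q : ℂ) ^ (1 / 2 + Complex.I * z) - (q : ℂ) ^ (-(1 / 2) - Complex.I * z)) /
      ((q : ℂ) ^ (Complex.I * z) - (q : ℂ) ^ (-(Complex.I * z))))

/-- The normalizing constant of the Plancherel measure: the value for which `μ` has total mass `1`
on `[0, τ]` with `τ = π / log q`, as the inversion formula at the vertex `o` requires. -/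
noncomputable def plancherelConst (q : ℕ) : ℝ :=
  (q : ℝ) * Real.log q / (2 * Real.pi * ((q : ℝ) + 1))

/-- The Plancherel measure `dμ(s) = c_P |c(s)|⁻² ds` on `[0, τ]`. -/
noncomputable def plancherelMeasure (q : ℕ) : Measure (Spectrum q) :=
  (Measure.comap ((↑) : Spectrum q → ℝ) volume).withDensity fun s =>
    ENNReal.ofReal (plancherelConst q * (‖cFunction q ((s : ℝ) : ℂ)‖ ^ 2)⁻¹)

end Plancherel

section Transform

variable {V : Type*} {G : SimpleGraph V} {o : V}

/-- The product measure `ν × μ` on `Ω × [0, τ]`. -/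
noncomputable def spectralMeasure (G : SimpleGraph V) (o : V) (q : ℕ) :
    Measure (Boundary G o × Spectrum q) :=
  (boundaryMeasure G o q).prod (plancherelMeasure q)

/-- `q ^ ((1/2 + i s) h_ω(x))`. -/
noncomputable def wavePlus (q : ℕ) (x : V) (p : Boundary G o × Spectrum q) : ℂ :=
  (q : ℂ) ^ ((1 / 2 + Complex.I * ((p.2 : ℝ) : ℂ)) * ((height p.1 x : ℤ) : ℂ))

/-- `q ^ ((1/2 - i s) h_ω(x))`. -/
noncomputable def waveMinus (q : ℕ) (x : V) (p : Boundary G o × Spectrum q) : ℂ :=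
  (q : ℂ) ^ ((1 / 2 - Complex.I * ((p.2 : ℝ) : ℂ)) * ((height p.1 x : ℤ) : ℂ))

/-- The Fourier-Helgason transform `ℋ f(ω, s) = ∑_y f(y) q ^ ((1/2 + i s) h_ω(y))` of a finitely
supported function `f` (the sum is then finite). -/
noncomputable def helgason (q : ℕ) (f : V → ℂ) (p : Boundary G o × Spectrum q) : ℂ :=
  ∑' y, f y * wavePlus q y p

/-- The pseudo-differential operator with symbol `σ`, on finitely supported functions:
`T_σ f(x) = ∫_Ω ∫_0^τ q ^ ((1/2 - i s) h_ω(x)) σ(x, ω, s) ℋ f(ω, s) dν(ω) dμ(s)`. -/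
noncomputable def pseudoDiff (q : ℕ) (σ : V → Boundary G o → Spectrum q → ℂ) (f : V → ℂ) (x : V) :
    ℂ :=
  ∫ p, waveMinus q x p * σ x p.1 p.2 * helgason q f p ∂(spectralMeasure G o q)

/-- The integrals that define `T_σ f`, for finitely supported `f`, converge absolutely. -/
def PseudoDiffDefined (q : ℕ) (σ : V → Boundary G o → Spectrum q → ℂ) : Prop :=
  ∀ f : V → ℂ, f.support.Finite → ∀ x,
    Integrable (fun p => waveMinus q x p * σ x p.1 p.2 * helgason q f p) (spectralMeasure G o q)

/-- `F` is the Fourier-Helgason transform of `g ∈ L²(𝔛)`: the isometric extension of the transform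
from the finitely supported functions, that is, the `L²`-limit of the transforms of the restrictions
of `g` to finite sets of vertices. -/
def IsL2Transform (q : ℕ) (g : V → ℂ) (F : Boundary G o × Spectrum q → ℂ) : Prop :=
  MemLp F 2 (spectralMeasure G o q) ∧
    Tendsto (fun A : Finset V =>
      eLpNorm (fun p => F p - helgason q (Set.indicator (A : Set V) g) p) 2 (spectralMeasure G o q))
      atTop (𝓝 0)

/-- The integrable function `F` is the Fourier-Helgason transform of `g` in the sense of the
inversion formula: `g(y) = ∫_Ω ∫_0^τ q ^ ((1/2 - i s) h_ω(y)) F(ω, s) dν(ω) dμ(s)`. -/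
def IsL1Transform (q : ℕ) (g : V → ℂ) (F : Boundary G o × Spectrum q → ℂ) : Prop :=
  Integrable F (spectralMeasure G o q) ∧
    ∀ y, ∫ p, waveMinus q y p * F p ∂(spectralMeasure G o q) = g y

/-- For an arbitrary function `g` the transform `ℋ g` is a functional on the transforms `ℋ φ` of
finitely supported functions, given by the Plancherel formula:
`⟨ℋ φ, ℋ g⟩ = ∑_y φ(y) conj (g(y))`. -/
noncomputable def helgasonPairing (φ g : V → ℂ) : ℂ := ∑' y, φ y * conj (g y)

end Transform

section Nuclear

/-- Nuclear operators between Banach spaces. -/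
def IsNuclear {E F : Type*} [NormedAddCommGroup E] [NormedSpace ℂ E] [NormedAddCommGroup F]
    [NormedSpace ℂ F] (T : E →L[ℂ] F) : Prop :=
  ∃ (x' : ℕ → StrongDual ℂ E) (y : ℕ → F), Summable (fun n => ‖x' n‖ * ‖y n‖) ∧
    ∀ x, HasSum (fun n => x' n x • y n) (T x)

variable {V : Type*} {G : SimpleGraph V} {o : V}

/-- `L^p(𝔛)` with respect to the counting measure. -/
noncomputable abbrev LpTree (V : Type*) (p : ℝ≥0∞) := lp (fun _ : V => ℂ) p

/-- `T_σ : L^{p₁}(𝔛) → L^{p₂}(𝔛)` is nuclear: `T_σ` is defined on the finitely supported functions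
and is given on them by a nuclear operator from `L^{p₁}(𝔛)` to `L^{p₂}(𝔛)`. -/
def IsNuclearPseudoDiff (q : ℕ) (σ : V → Boundary G o → Spectrum q → ℂ) (p₁ p₂ : ℝ≥0∞)
    [Fact (1 ≤ p₁)] [Fact (1 ≤ p₂)] : Prop :=
  PseudoDiffDefined q σ ∧
    ∃ T : LpTree V p₁ →L[ℂ] LpTree V p₂,
      (∀ u : LpTree V p₁, (Function.support (u : V → ℂ)).Finite →
        ∀ x, (T u : V → ℂ) x = pseudoDiff q σ u x) ∧
      IsNuclear T

end Nuclear

section Decomposition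

variable {V : Type*} {G : SimpleGraph V} {o : V}

/-- `σ(x, ω, s) = q ^ (-(1/2 - i s) h_ω(x)) ∑_k f_k(x) conj (ℋ (conj g_k) (ω, s))`, where
`ℋ (conj g_k)` is the `L²`-transform, for sequences `g_k` in `L^r(𝔛)` and `f_k` in `L^{p₂}(𝔛)` with
`∑_k ‖g_k‖ ‖f_k‖ < ∞`. -/
def HasL2Decomposition (q : ℕ) (σ : V → Boundary G o → Spectrum q → ℂ) (r p₂ : ℝ≥0∞) : Prop :=
  ∃ (g : ℕ → LpTree V r) (f : ℕ → LpTree V p₂) (F : ℕ → Boundary G o × Spectrum q → ℂ),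
    Summable (fun k => ‖g k‖ * ‖f k‖) ∧
    (∀ k, IsL2Transform q (fun y => conj (g k y)) (F k)) ∧
    ∀ x, ∀ᵐ p ∂(spectralMeasure G o q),
      Summable (fun k => f k x * conj (F k p)) ∧
      σ x p.1 p.2 = (waveMinus q x p)⁻¹ * ∑' k, f k x * conj (F k p)

/-- The same decomposition, where the transform of each `conj g_k` is an integrable function and the
series converges absolutely in `L¹` for every `x`. -/
def HasL1Decomposition (q : ℕ) (σ : V → Boundary G o → Spectrum q → ℂ) (r p₂ : ℝ≥0∞) : Prop :=
  ∃ (g : ℕ → LpTree V r) (f : ℕ → LpTree V p₂) (F : ℕ → Boundary G o × Spectrum q → ℂ),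
    Summable (fun k => ‖g k‖ * ‖f k‖) ∧
    (∀ k, IsL1Transform q (fun y => conj (g k y)) (F k)) ∧
    (∀ x, Summable (fun k => ‖f k x‖ * ∫ p, ‖F k p‖ ∂(spectralMeasure G o q))) ∧
    ∀ x, ∀ᵐ p ∂(spectralMeasure G o q),
      Summable (fun k => f k x * conj (F k p)) ∧
      σ x p.1 p.2 = (waveMinus q x p)⁻¹ * ∑' k, f k x * conj (F k p)

/-- The same decomposition in the weak sense: for every `x`, the function
`q ^ ((1/2 - i s) h_ω(x)) σ(x, ω, s)` and the series `∑_k f_k(x) conj (ℋ (conj g_k))` agree as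
functionals on the transforms `ℋ φ` of the finitely supported functions `φ`; here
`conj (ℋ (conj g_k))` takes the value `⟨ℋ φ, ℋ (conj g_k)⟩` at `ℋ φ`. -/
def HasWeakDecomposition (q : ℕ) (σ : V → Boundary G o → Spectrum q → ℂ) (r p₂ : ℝ≥0∞) : Prop :=
  PseudoDiffDefined q σ ∧
  ∃ (g : ℕ → LpTree V r) (f : ℕ → LpTree V p₂),
    Summable (fun k => ‖g k‖ * ‖f k‖) ∧
    ∀ x, ∀ φ : V → ℂ, φ.support.Finite →
      HasSum (fun k => f k x * helgasonPairing φ (fun y => conj (g k y)))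
        (∫ p, waveMinus q x p * σ x p.1 p.2 * helgason q φ p ∂(spectralMeasure G o q))

end Decomposition

end HomogeneousTree

/-!
The waves `q ^ ((1/2 + i s) h_ω(x))`, `x ∈ V`, are an orthonormal system in `L²(ν × μ)`
(`integral_wavePlus_mul_waveMinus`). Integrated over the boundary, a wave times a conjugate wave is a
spherical function of the distance of the two vertices (`integral_zpow_height_mul`): from a vertex
to a child the wave is divided by `q ^ (1/2 + i s)` and a multiple of the indicator function of the
set `E(x)` of rays through the child is added, and the spherical functions obey the same recursion.
The integral over `s` is the difference of two cosine coefficients `J d`, `J (d + 2)` of the function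
`1 / (1 - w² / q)`, `w = q ^ {i s}`. All of positive order vanish on the half period `[0, τ]`
(`integral_phase_geomKernel`), since they are bounded and `J d = J (d + 2) / q` for `d ≠ 0`.
So the transform extends to an isometry of `ℓ²` into `L²(ν × μ)`.

The inversion formula determines an integrable transform (`AnnihilatesWaves.ae_eq_zero`). The waves
are eigenfunctions of the adjacency operator with an eigenvalue proportional to `cos (s log q)`.
Hence the functions in `L¹(ν × μ)` that annihilate all waves are stable under multiplication by
`cos (s log q)`, and by the Stone–Weierstrass theorem under multiplication by every continuous
function of `s`. The step from a vertex to a child turns waves into indicator functions of the sets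
`E(x)`, so such a function has integral zero over all products `E(x) × C` with `C` closed. These
products form a π-system that generates the σ-algebra.

As the dual of `ℓ^{p₁}` is `ℓ^{p₁'}` and finitely supported functions can be tested coordinate by
coordinate, nuclearity is the same as the weak form of the decomposition
(`HasWeakDecomposition.isNuclearPseudoDiff`, `IsNuclearPseudoDiff.hasWeakDecomposition`). A
decomposition whose series converges absolutely in `L¹` gives a weak one by integration term by term
(`HasL1Decomposition.hasWeakDecomposition`), and for `p₁' ≤ 2` the `L²`-decompositions are of this
kind since `‖·‖_{L¹} ≤ ‖·‖_{L²} ≤ ‖·‖_{p₁'}` along the isometry. Conversely, for `p₁' ≤ 2` the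
symbol and the series built with the isometry have the same integrals against all waves, and
injectivity identifies them (`HasWeakDecomposition.hasL2Decomposition`).

For `2 < p₁' < ∞` the individual `g_k` need not have an integrable transform, but each row
`∑ f_k(x) g_k` of the kernel has one, namely the symbol itself. Finitely supported functions being
dense in `ℓ^{p₂}` and `ℓ^{p₁'}`, the nuclear series can be rearranged into finitely many finitely
supported terms for each finite block of vertices and one small correction `δ_x ⊗ R_x` for each
vertex `x`. Then `R_x` is the row minus a finitely supported function, so its transform is integrable
(`HasWeakDecomposition.hasL1Decomposition`). For `p₁' = ∞` this density fails.
-/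

namespace HomogeneousTree

/-! ### Rays and heights -/

section Tree

variable {V : Type*} {G : SimpleGraph V} {o : V}

theorem Boundary.dist_origin (ω : Boundary G o) (n : ℕ) : G.dist o (ω.ray n) = n := by
  have h := ω.dist_ray 0 n
  rwa [ω.ray_zero, zero_add] at h

theorem Boundary.adj (ω : Boundary G o) (n : ℕ) : G.Adj (ω.ray n) (ω.ray (n + 1)) :=
  SimpleGraph.dist_eq_one_iff_adj.1 (ω.dist_ray n 1)

/-- A geodesic from `a` to `x ≠ a` arrives through the neighbour of `x` that is closer to `o`,
as soon as `a` lies on the geodesic `[o, x]`. -/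
theorem dist_parent (hG : G.IsTree) {a u x : V} (hux : G.Adj u x)
    (hd : G.dist o x = G.dist o u + 1) (ha : G.dist o a + G.dist a x = G.dist o x) (hax : a ≠ x) :
    G.dist o a + G.dist a u = G.dist o u := by
  have hpos : G.dist a x ≠ 0 := by
    rw [Ne, hG.connected.dist_eq_zero_iff]
    exact hax
  obtain ⟨n, hn⟩ := Nat.exists_eq_succ_of_ne_zero hpos
  obtain ⟨v, hv, hvn⟩ := exists_parent hG hn
  have h1 := hG.connected.dist_triangle (u := o) (v := a) (w := v)
  have h2 := hG.dist_eq_dist_add_one_of_adj o hv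
  have huv : v = u := parent_unique (o := o) hG hv hux (by omega) hd
  subst huv
  omega

theorem confluence_le (ω : Boundary G o) (x : V) : confluence ω x ≤ G.dist o x :=
  Nat.findGreatest_le _

theorem confluence_spec (ω : Boundary G o) (x : V) :
    confluence ω x + G.dist (ω.ray (confluence ω x)) x = G.dist o x := by
  classical
  have h := Nat.findGreatest_spec
    (P := fun n => G.dist o (ω.ray n) + G.dist (ω.ray n) x = G.dist o x) (m := 0)
    (n := G.dist o x) (Nat.zero_le _) (by simp [ω.ray_zero])
  have h2 : Nat.findGreatest (fun n => G.dist o (ω.ray n) + G.dist (ω.ray n) x = G.dist o x)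
      (G.dist o x) = confluence ω x := by
    unfold confluence
    congr!
  rw [h2, ω.dist_origin] at h
  exact h

theorem le_confluence (ω : Boundary G o) (x : V) {n : ℕ}
    (h : n + G.dist (ω.ray n) x = G.dist o x) : n ≤ confluence ω x := by
  unfold confluence
  exact Nat.le_findGreatest (by omega) (by rwa [ω.dist_origin])

/-- Beyond the confluence point the ray leaves `y` along a geodesic. -/
theorem dist_ray_add_confluence (hG : G.IsTree) (ω : Boundary G o) (y : V) (k : ℕ) :
    G.dist (ω.ray (confluence ω y + k)) y + confluence ω y = k + G.dist o y := by
  induction k using Nat.strong_induction_on with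
  | _ k ih =>
    rcases k with _ | k
    · have := confluence_spec ω y
      simp only [add_zero, zero_add]
      omega
    have ih1 := ih k (by omega)
    have hadj := ω.adj (confluence ω y + k)
    have hsymm : ∀ a b : V, G.dist a b = G.dist b a := fun a b => SimpleGraph.dist_comm
    rcases hG.dist_eq_dist_add_one_of_adj y hadj with h | h
    · -- the ray would come one step closer to `y`
      exfalso
      rw [hsymm y, hsymm y] at h
      rcases k with _ | k
      · have := le_confluence ω y (n := confluence ω y + 1) (by
          simp only [add_zero] at h ih1
          omega)
        omega
      · have ih2 := ih k (by omega)
        have hadj2 := ω.adj (confluence ω y + k)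
        have heq := parent_unique (o := y) hG (u := ω.ray (confluence ω y + k))
          (w := ω.ray (confluence ω y + (k + 1) + 1)) (v := ω.ray (confluence ω y + (k + 1)))
          hadj2 hadj.symm (by
            rw [hsymm y, hsymm y]
            omega) (by
            rw [hsymm y, hsymm y]
            omega)
        have h3 := ω.dist_ray (confluence ω y + k) 2
        rw [heq, show confluence ω y + (k + 1) + 1 = confluence ω y + k + 2 by ring] at h3
        simp at h3
    · rw [hsymm y, hsymm y] at h
      rw [show confluence ω y + (k + 1) = confluence ω y + k + 1 by ring]
      omega

/-- The height is the Busemann function of the ray. -/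
theorem height_eq_sub_dist (hG : G.IsTree) (ω : Boundary G o) (y : V) {n : ℕ}
    (hn : confluence ω y ≤ n) : height ω y = n - G.dist (ω.ray n) y := by
  obtain ⟨k, rfl⟩ := Nat.exists_eq_add_of_le hn
  have := dist_ray_add_confluence hG ω y k
  unfold height
  push_cast
  omega

theorem mem_cylinder {x : V} {ω : Boundary G o} :
    ω ∈ cylinder G o x ↔ ω.ray (G.dist o x) = x := Iff.rfl

theorem mem_cylinder_iff (hG : G.IsTree) {x : V} {ω : Boundary G o} :
    ω ∈ cylinder G o x ↔ confluence ω x = G.dist o x := by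
  rw [mem_cylinder]
  constructor
  · intro h
    refine le_antisymm (confluence_le ω x) (le_confluence ω x ?_)
    rw [h]
    simp
  · intro h
    have h2 := confluence_spec ω x
    rw [h] at h2
    exact hG.connected.dist_eq_zero_iff.1 (by omega)

theorem height_of_mem_cylinder (hG : G.IsTree) {x : V} {ω : Boundary G o}
    (h : ω ∈ cylinder G o x) : height ω x = G.dist o x := by
  rw [mem_cylinder_iff hG] at h
  unfold height
  omega

theorem mem_cylinder_parent (hG : G.IsTree) {u x : V} (hux : G.Adj u x)
    (hd : G.dist o x = G.dist o u + 1) {ω : Boundary G o}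
    (h : ω ∈ cylinder G o x) : ω ∈ cylinder G o u := by
  rw [mem_cylinder] at *
  refine parent_unique (o := o) (v := x) hG ?_ hux ?_ hd
  · rw [← h, hd]
    simpa [hd] using ω.adj (G.dist o u)
  · rw [ω.dist_origin, hd]

theorem height_of_not_mem_cylinder (hG : G.IsTree) {u x : V} (hux : G.Adj u x)
    (hd : G.dist o x = G.dist o u + 1) {ω : Boundary G o} (h : ω ∉ cylinder G o x) :
    height ω x = height ω u - 1 := by
  have hc : confluence ω x = confluence ω u := by
    apply le_antisymm
    · apply le_confluence
      have h1 := confluence_spec ω x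
      have h2 := dist_parent (o := o) hG (a := ω.ray (confluence ω x)) hux hd
        (by rw [ω.dist_origin, h1]) (by
          intro h3
          apply h
          rw [mem_cylinder_iff hG]
          rw [h3] at h1
          simpa using h1)
      rwa [ω.dist_origin] at h2
    · apply le_confluence
      have h1 := confluence_spec ω u
      have h2 := hG.connected.dist_triangle (u := ω.ray (confluence ω u)) (v := u) (w := x)
      have h3 := hG.connected.dist_triangle (u := o) (v := ω.ray (confluence ω u)) (w := x)
      have h4 := SimpleGraph.dist_eq_one_iff_adj.2 hux
      rw [ω.dist_origin] at h3
      omega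
  unfold height
  rw [hc, hd]
  push_cast
  ring

/-- On the rays through `x`, the height of a vertex `y` that does not lie behind `x` is
constant. -/
theorem height_eq_of_mem_cylinder (hG : G.IsTree) {x y : V} {ω : Boundary G o}
    (h : ω ∈ cylinder G o x) (hy : G.dist o x + G.dist x y ≠ G.dist o y) :
    height ω y = G.dist o x - G.dist x y := by
  rw [height_eq_sub_dist hG ω y (n := G.dist o x), mem_cylinder.1 h]
  by_contra hlt
  push Not at hlt
  -- a point of the ray before the confluence point lies on `[o, y]`
  have h1 := confluence_spec ω y
  have h2 := ω.dist_ray (G.dist o x) (confluence ω y - G.dist o x)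
  rw [Nat.add_sub_cancel' hlt.le, mem_cylinder.1 h] at h2
  have h3 := hG.connected.dist_triangle (u := x) (v := ω.ray (confluence ω y)) (w := y)
  have h4 := hG.connected.dist_triangle (u := o) (v := x) (w := y)
  omega

/-- Exactly one neighbour of a vertex lies in the direction of the boundary point. -/
theorem exists_unique_neighbor_height (hG : G.IsTree) (ω : Boundary G o) (x : V) :
    ∃ v, G.Adj x v ∧ height ω v = height ω x + 1 ∧
      ∀ w, G.Adj x w → w ≠ v → height ω w = height ω x - 1 := by
  have hsymm : ∀ a b : V, G.dist a b = G.dist b a := fun a b => SimpleGraph.dist_comm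
  set n := G.dist o x + 1 with hn
  have hx := height_eq_sub_dist hG ω x (n := n) ((confluence_le ω x).trans (by omega))
  have hw : ∀ w, G.Adj x w → height ω w = n - G.dist (ω.ray n) w := fun w hw => by
    apply height_eq_sub_dist hG
    have h1 := confluence_le ω w
    rcases hG.dist_eq_dist_add_one_of_adj o hw with h | h <;> omega
  have hpos : G.dist (ω.ray n) x ≠ 0 := by
    rw [Ne, hG.connected.dist_eq_zero_iff]
    intro h
    have := ω.dist_origin n
    rw [h] at this
    omega
  obtain ⟨m, hm⟩ := Nat.exists_eq_succ_of_ne_zero hpos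
  obtain ⟨v, hv, hvm⟩ := exists_parent hG hm
  refine ⟨v, hv.symm, ?_, ?_⟩
  · rw [hw v hv.symm, hx]
    omega
  · intro w hxw hwv
    rw [hw w hxw, hx]
    rcases hG.dist_eq_dist_add_one_of_adj (ω.ray n) hxw with h | h
    · exact absurd (parent_unique (o := ω.ray n) hG hxw.symm hv h (by omega)) hwv
    · omega

theorem countable_of_locallyFinite (hG : G.IsTree) {q : ℕ}
    (hreg : ∀ v, (G.neighborSet v).ncard = q + 1) : Countable V := by
  obtain ⟨o⟩ := hG.connected.nonempty
  have h : ∀ n : ℕ, {v | G.dist o v = n}.Finite := by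
    intro n
    induction n with
    | zero =>
      refine (Set.finite_singleton o).subset fun v hv => ?_
      exact (hG.connected.dist_eq_zero_iff.1 hv).symm
    | succ n ih =>
      refine (ih.biUnion (t := fun u => G.neighborSet u) fun u _ =>
        Set.finite_of_ncard_ne_zero (by rw [hreg u]; omega)).subset fun v hv => ?_
      obtain ⟨u, hu, hun⟩ := exists_parent hG hv
      exact Set.mem_biUnion (x := u) hun hu
  have : (Set.univ : Set V) = ⋃ n : ℕ, {v | G.dist o v = n} := by
    ext v
    simp
  rw [← Set.countable_univ_iff, this]
  exact Set.countable_iUnion fun n => (h n).countable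

end Tree

/-! ### The boundary measure -/

section BoundaryMeasure

variable {V : Type*} {G : SimpleGraph V} {o : V}

theorem measurableSet_cylinder (x : V) : MeasurableSet (cylinder G o x) :=
  MeasurableSpace.measurableSet_generateFrom ⟨x, rfl⟩

theorem cylinder_root : cylinder G o o = Set.univ := by
  ext ω
  simp [mem_cylinder, ω.ray_zero]

/-- Two rays that meet at time `n` coincide up to time `n`. -/
theorem ray_eq_of_le (hG : G.IsTree) {ω η : Boundary G o} {n k : ℕ} (h : ω.ray n = η.ray n)
    (hk : k ≤ n) : ω.ray k = η.ray k := by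
  obtain ⟨m, rfl⟩ := Nat.exists_eq_add_of_le hk
  induction m with
  | zero => exact h
  | succ m ih =>
    refine ih (parent_unique (o := o) (v := ω.ray (k + m + 1)) hG (ω.adj _) ?_ ?_ ?_) (by omega)
    · rw [show ω.ray (k + m + 1) = η.ray (k + m + 1) from h]
      exact η.adj _
    all_goals simp only [Boundary.dist_origin]

theorem isPiSystem_cylinder (hG : G.IsTree) : IsPiSystem (Set.range (cylinder G o)) := by
  have key : ∀ x y : V, G.dist o x ≤ G.dist o y → ∀ ω, ω ∈ cylinder G o x ∩ cylinder G o y →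
      cylinder G o x ∩ cylinder G o y = cylinder G o y := by
    rintro x y hxy ω ⟨hx, hy⟩
    refine Set.inter_eq_right.2 fun η hη => ?_
    rw [mem_cylinder] at *
    rw [← ray_eq_of_le hG (hy.trans hη.symm) hxy, hx]
  rintro _ ⟨x, rfl⟩ _ ⟨y, rfl⟩ ⟨ω, hω⟩
  rcases le_total (G.dist o x) (G.dist o y) with h | h
  · exact ⟨y, (key x y h ω hω).symm⟩
  · refine ⟨x, ?_⟩
    rw [Set.inter_comm]
    exact (key y x h ω hω.symm).symm

theorem height_root (ω : Boundary G o) : height ω o = 0 := by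
  have h := confluence_le ω o
  rw [SimpleGraph.dist_self] at h
  unfold height
  rw [SimpleGraph.dist_self]
  omega

/-- Induction along the geodesics that start at `o`. -/
theorem tree_induction (hG : G.IsTree) {P : V → Prop} (root : P o)
    (child : ∀ u x, G.Adj u x → G.dist o x = G.dist o u + 1 → P u → P x) (x : V) : P x := by
  induction hn : G.dist o x generalizing x with
  | zero => rwa [← hG.connected.dist_eq_zero_iff.1 hn]
  | succ n ih =>
    obtain ⟨u, hu, hun⟩ := exists_parent hG hn
    exact child u x hu (by omega) (ih u hun)

theorem measurable_height (hG : G.IsTree) (x : V) :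
    Measurable fun ω : Boundary G o => height ω x := by
  classical
  induction x using tree_induction (o := o) hG with
  | root => simp [height_root]
  | child u x hux hd ih =>
    have : (fun ω : Boundary G o => height ω x) =
        fun ω => if ω ∈ cylinder G o x then (G.dist o x : ℤ) else height ω u - 1 := by
      funext ω
      split_ifs with h
      · exact height_of_mem_cylinder hG h
      · exact height_of_not_mem_cylinder hG hux hd h
    rw [this]
    exact Measurable.ite (measurableSet_cylinder x) measurable_const (ih.sub_const 1)

theorem abs_height_le (ω : Boundary G o) (x : V) : |height ω x| ≤ G.dist o x := by
  have := confluence_le ω x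
  rw [abs_le]
  unfold height
  omega

end BoundaryMeasure

/-! ### The waves `q ^ ((1/2 + i s) h_ω(x))` -/

section Wave

variable {V : Type*} {G : SimpleGraph V} {o : V} {q : ℕ}

/-- The point `q ^ {i s}` of the unit circle. -/
noncomputable def phase (q : ℕ) (s : ℝ) : ℂ := Complex.exp ((s * Real.log q : ℝ) * Complex.I)

/-- `q ^ {1/2 + i s}`. -/
noncomputable def waveBase (q : ℕ) (s : ℝ) : ℂ := (√q : ℝ) * phase q s

theorem phase_ne_zero (s : ℝ) : phase q s ≠ 0 := Complex.exp_ne_zero _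

theorem norm_phase (s : ℝ) : ‖phase q s‖ = 1 := Complex.norm_exp_ofReal_mul_I _

theorem conj_phase (s : ℝ) : conj (phase q s) = (phase q s)⁻¹ :=
  (Complex.inv_eq_conj (norm_phase s)).symm

theorem continuous_phase : Continuous (phase q) := by
  unfold phase
  fun_prop

theorem continuous_waveBase : Continuous (waveBase q) := by
  unfold waveBase
  exact continuous_const.mul continuous_phase

theorem norm_waveBase (s : ℝ) : ‖waveBase q s‖ = √q := by
  simp [waveBase, norm_phase, abs_of_nonneg (Real.sqrt_nonneg _)]

theorem waveBase_ne_zero (hq : 2 ≤ q) (s : ℝ) : waveBase q s ≠ 0 := by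
  rw [← norm_pos_iff, norm_waveBase]
  positivity

theorem conj_waveBase (s : ℝ) : conj (waveBase q s) = (√q : ℝ) * (phase q s)⁻¹ := by
  rw [waveBase, map_mul, conj_phase, Complex.conj_ofReal]

theorem waveBase_mul_conj (s : ℝ) : waveBase q s * conj (waveBase q s) = q := by
  rw [Complex.mul_conj, Complex.normSq_eq_norm_sq, norm_waveBase, Real.sq_sqrt (by positivity)]
  simp

theorem cpow_I_mul (hq : 2 ≤ q) (s : ℝ) : (q : ℂ) ^ (Complex.I * s) = phase q s := by
  have : (q : ℂ) ≠ 0 := by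
    norm_cast
    omega
  rw [Complex.cpow_def_of_ne_zero this, phase, ← Complex.natCast_log]
  congr 1
  push_cast
  ring

theorem cpow_half : (q : ℂ) ^ (1 / 2 : ℂ) = (√q : ℝ) := by
  rw [Real.sqrt_eq_rpow, Complex.ofReal_cpow (by positivity)]
  norm_num

theorem wavePlus_eq (hq : 2 ≤ q) (x : V) (p : Boundary G o × Spectrum q) :
    wavePlus q x p = waveBase q p.2 ^ height p.1 x := by
  have : (q : ℂ) ≠ 0 := by
    norm_cast
    omega
  rw [wavePlus, Complex.cpow_mul_int, Complex.cpow_add _ _ this, cpow_I_mul hq, cpow_half, waveBase]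

theorem waveMinus_eq (hq : 2 ≤ q) (x : V) (p : Boundary G o × Spectrum q) :
    waveMinus q x p = conj (waveBase q p.2) ^ height p.1 x := by
  have : (q : ℂ) ≠ 0 := by
    norm_cast
    omega
  rw [waveMinus, Complex.cpow_mul_int, Complex.cpow_sub _ _ this, cpow_I_mul hq, cpow_half,
    conj_waveBase, div_eq_mul_inv]

theorem conj_wavePlus (hq : 2 ≤ q) (x : V) (p : Boundary G o × Spectrum q) :
    conj (wavePlus q x p) = waveMinus q x p := by
  rw [wavePlus_eq hq, waveMinus_eq hq, map_zpow₀]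

theorem conj_waveMinus (hq : 2 ≤ q) (x : V) (p : Boundary G o × Spectrum q) :
    conj (waveMinus q x p) = wavePlus q x p := by
  rw [← conj_wavePlus hq, Complex.conj_conj]

theorem waveMinus_ne_zero (hq : 2 ≤ q) (x : V) (p : Boundary G o × Spectrum q) :
    waveMinus q x p ≠ 0 := by
  rw [waveMinus_eq hq]
  exact zpow_ne_zero _ (by simpa using waveBase_ne_zero hq _)

theorem measurable_wavePlus (hG : G.IsTree) (x : V) :
    Measurable (wavePlus q x : Boundary G o × Spectrum q → ℂ) := by
  unfold wavePlus
  have h1 : Measurable fun p : Boundary G o × Spectrum q => ((height p.1 x : ℤ) : ℂ) :=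
    (measurable_from_top (f := fun n : ℤ => (n : ℂ))).comp ((measurable_height hG x).comp measurable_fst)
  have h2 : Measurable fun p : Boundary G o × Spectrum q => (((p.2 : ℝ)) : ℂ) := by fun_prop
  fun_prop

theorem norm_wavePlus_le (hq : 2 ≤ q) (x : V) (p : Boundary G o × Spectrum q) :
    ‖wavePlus q x p‖ ≤ √q ^ G.dist o x := by
  rw [wavePlus_eq hq, norm_zpow, norm_waveBase, ← zpow_natCast]
  have h1 : 1 ≤ √(q : ℝ) := by
    rw [Real.one_le_sqrt]
    exact_mod_cast (by omega : 1 ≤ q)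
  exact zpow_le_zpow_right₀ h1 ((le_abs_self _).trans (abs_height_le p.1 x))

theorem measurable_waveMinus (hq : 2 ≤ q) (hG : G.IsTree) (x : V) :
    Measurable (waveMinus q x : Boundary G o × Spectrum q → ℂ) := by
  have : (waveMinus q x : Boundary G o × Spectrum q → ℂ) = fun p => conj (wavePlus q x p) := by
    funext p
    rw [conj_wavePlus hq]
  rw [this]
  exact Complex.continuous_conj.measurable.comp (measurable_wavePlus hG x)

theorem norm_waveMinus_le (hq : 2 ≤ q) (x : V) (p : Boundary G o × Spectrum q) :
    ‖waveMinus q x p‖ ≤ √q ^ G.dist o x := by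
  rw [← conj_wavePlus hq, Complex.norm_conj]
  exact norm_wavePlus_le hq x p

open Classical in
/-- The step from a vertex to its child: up to a factor, the difference of the waves is the
indicator function of the set of rays through the child. -/
theorem zpow_height_child (hG : G.IsTree) {u x : V} (hux : G.Adj u x)
    (hd : G.dist o x = G.dist o u + 1) (ω : Boundary G o) {z : ℂ} (hz : z ≠ 0) :
    z ^ height ω x = z⁻¹ * z ^ height ω u +
      if ω ∈ cylinder G o x then z ^ (G.dist o x : ℤ) * (1 - (z ^ 2)⁻¹) else 0 := by
  split_ifs with h
  · rw [height_of_mem_cylinder hG h, height_of_mem_cylinder hG (mem_cylinder_parent hG hux hd h), hd]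
    push_cast
    rw [zpow_add_one₀ hz]
    field_simp
    ring
  · rw [height_of_not_mem_cylinder hG hux hd h, zpow_sub_one₀ hz]
    ring

/-- The waves are eigenfunctions of the adjacency operator. -/
theorem sum_neighbor_wavePlus (hq : 2 ≤ q) (hG : G.IsTree)
    (hreg : ∀ v, (G.neighborSet v).ncard = q + 1) (x : V) (S : Finset V)
    (hS : (S : Set V) = G.neighborSet x) (p : Boundary G o × Spectrum q) :
    ∑ y ∈ S, wavePlus q y p = (2 * √q * Real.cos (p.2 * Real.log q) : ℝ) * wavePlus q x p := by
  classical
  obtain ⟨v, hv, hv1, hv2⟩ := exists_unique_neighbor_height hG p.1 x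
  have hmem : ∀ y, y ∈ S ↔ G.Adj x y := fun y => by
    rw [← Finset.mem_coe, hS, SimpleGraph.mem_neighborSet]
  have hcard : S.card = q + 1 := by
    rw [← hreg x, ← hS, Set.ncard_coe_finset]
  have hz := waveBase_ne_zero hq p.2
  have hw := phase_ne_zero (q := q) p.2
  rw [← Finset.add_sum_erase S _ ((hmem v).2 hv), Finset.sum_congr rfl fun y hy => by
    rw [wavePlus_eq hq, hv2 y ((hmem y).1 (Finset.mem_of_mem_erase hy)) (Finset.ne_of_mem_erase hy)],
    Finset.sum_const, Finset.card_erase_of_mem ((hmem v).2 hv), hcard, wavePlus_eq hq, hv1,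
    wavePlus_eq hq, zpow_add_one₀ hz, zpow_sub_one₀ hz, nsmul_eq_mul, Nat.add_sub_cancel]
  have h1 : (q : ℂ) * (waveBase q p.2)⁻¹ = (√q : ℝ) * (phase q p.2)⁻¹ := by
    rw [← waveBase_mul_conj p.2.1, conj_waveBase]
    field_simp
  have h2 : ((2 * √q * Real.cos (p.2 * Real.log q) : ℝ) : ℂ) =
      (√q : ℝ) * (phase q p.2 + (phase q p.2)⁻¹) := by
    push_cast
    rw [mul_right_comm, Complex.two_cos, phase, ← Complex.exp_neg, mul_comm]
    push_cast
    ring_nf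
  rw [h2, mul_left_comm, h1, waveBase]
  ring

end Wave

/-! ### The Plancherel measure -/

section PlancherelMeasure

variable {q : ℕ}

theorem log_pos (hq : 2 ≤ q) : 0 < Real.log q :=
  Real.log_pos (by exact_mod_cast (by omega : 1 < q))

theorem tau_pos (hq : 2 ≤ q) : 0 < tau q := div_pos Real.pi_pos (log_pos hq)

/-- `(1 - w² / q)⁻¹` at `w = q ^ {i s}`; its expansion into powers of `w` contains no negative
power. -/
noncomputable def geomKernel (q : ℕ) (s : ℝ) : ℂ := (1 - phase q s ^ 2 / q)⁻¹

theorem norm_phase_sq_div (hq : 2 ≤ q) (s : ℝ) : ‖phase q s ^ 2 / q‖ ≤ 1 / 2 := by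
  have h2 : (2 : ℝ) ≤ q := by exact_mod_cast hq
  simp only [norm_div, norm_pow, norm_phase, Complex.norm_natCast, one_pow]
  gcongr

theorem one_sub_phase_ne_zero (hq : 2 ≤ q) (s : ℝ) : 1 - phase q s ^ 2 / q ≠ 0 := by
  intro h
  have h1 := norm_phase_sq_div hq s
  rw [← sub_eq_zero.1 h, norm_one] at h1
  norm_num at h1

theorem norm_geomKernel_le (hq : 2 ≤ q) (s : ℝ) : ‖geomKernel q s‖ ≤ 2 := by
  rw [geomKernel, norm_inv]
  have h1 := norm_phase_sq_div hq s
  have h2 := norm_sub_norm_le (1 : ℂ) (phase q s ^ 2 / q)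
  rw [norm_one] at h2
  exact inv_le_of_inv_le₀ (by norm_num) (by linarith)

theorem continuous_geomKernel (hq : 2 ≤ q) : Continuous (geomKernel q) := by
  unfold geomKernel
  refine Continuous.inv₀ ?_ (one_sub_phase_ne_zero hq)
  exact continuous_const.sub ((continuous_phase.pow 2).div_const _)

theorem phase_pow_re (d : ℕ) (s : ℝ) : (phase q s ^ d).re = Real.cos (d * (s * Real.log q)) := by
  rw [phase, ← Complex.exp_nat_mul, ← Complex.exp_ofReal_mul_I_re]
  congr 2
  push_cast
  ring

theorem integral_cos (hq : 2 ≤ q) (d : ℕ) :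
    ∫ s in (0 : ℝ)..tau q, Real.cos (d * (s * Real.log q)) = if d = 0 then tau q else 0 := by
  split_ifs with h
  · subst h
    simp
  · have hl := log_pos hq
    have hd : (d : ℝ) ≠ 0 := by exact_mod_cast h
    have h1 : ∀ s : ℝ, Real.cos (d * (s * Real.log q)) = Real.cos ((d * Real.log q) * s) :=
      fun s => by ring_nf
    simp_rw [h1]
    rw [intervalIntegral.integral_comp_mul_left (fun x => Real.cos x) (by positivity), _root_.integral_cos]
    have h2 : d * Real.log q * tau q = d * Real.pi := by
      unfold tau
      field_simp
    rw [h2]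
    simp [Real.sin_nat_mul_pi]

/-- The cosine coefficients of the geometric kernel on the half period. -/
theorem integral_phase_geomKernel (hq : 2 ≤ q) (d : ℕ) :
    ∫ s in (0 : ℝ)..tau q, (phase q s ^ d * geomKernel q s).re = if d = 0 then tau q else 0 := by
  set L : ℕ → ℝ := fun d => ∫ s in (0 : ℝ)..tau q, (phase q s ^ d * geomKernel q s).re with hL
  have hcont : ∀ d, Continuous fun s => (phase q s ^ d * geomKernel q s).re := fun d =>
    Complex.continuous_re.comp ((continuous_phase.pow d).mul (continuous_geomKernel hq))
  have hrec : ∀ d, L d = (if d = 0 then tau q else 0) + L (d + 2) / q := by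
    intro d
    rw [← integral_cos hq d, hL]
    rw [← intervalIntegral.integral_div, ← intervalIntegral.integral_add]
    · refine intervalIntegral.integral_congr fun s _ => ?_
      rw [← phase_pow_re, ← Complex.div_natCast_re, ← Complex.add_re, geomKernel]
      congr 1
      have h0 := one_sub_phase_ne_zero hq s
      have hq0 : (q : ℂ) ≠ 0 := by
        norm_cast
        omega
      have h0' : (q : ℂ) - phase q s ^ 2 ≠ 0 := by
        intro h
        apply h0
        field_simp
        simpa using h
      field_simp
      ring
    · exact Continuous.intervalIntegrable (by fun_prop) _ _
    · exact ((hcont _).div_const _).intervalIntegrable _ _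
  have hbound : ∀ d, |L d| ≤ 2 * tau q := by
    intro d
    have h := intervalIntegral.norm_integral_le_of_norm_le_const (a := 0) (b := tau q) (C := 2)
      (f := fun s => (phase q s ^ d * geomKernel q s).re) fun s _ => by
        refine (Complex.abs_re_le_norm _).trans ?_
        simpa [norm_phase] using norm_geomKernel_le hq s
    rwa [sub_zero, abs_of_pos (tau_pos hq)] at h
  have hzero : ∀ d, d ≠ 0 → L d = 0 := by
    have hstep : ∀ k d, d ≠ 0 → |L d| ≤ (1 / 2 : ℝ) ^ k * (2 * tau q) := by
      intro k
      induction k with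
      | zero => simpa using fun d _ => hbound d
      | succ k ih =>
        intro d hd
        rw [hrec d, if_neg hd, zero_add, abs_div, Nat.abs_cast, pow_succ]
        have h2 : (2 : ℝ) ≤ q := by exact_mod_cast hq
        have h1 := ih (d + 2) (by omega)
        calc |L (d + 2)| / q ≤ |L (d + 2)| / 2 := by gcongr
          _ ≤ _ := by linarith
    intro d hd
    have hlim : Tendsto (fun k : ℕ => (1 / 2 : ℝ) ^ k * (2 * tau q)) atTop (𝓝 (0 * (2 * tau q))) :=
      (tendsto_pow_atTop_nhds_zero_of_lt_one (by norm_num) (by norm_num)).mul_const _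
    rw [zero_mul] at hlim
    exact abs_nonpos_iff.1 (ge_of_tendsto' hlim fun k => hstep k d hd)
  change L d = _
  split_ifs with h
  · subst h
    rw [hrec, hzero _ (by norm_num)]
    simp
  · exact hzero d h

/-- The density of the Plancherel measure, in a form without singularities. -/
noncomputable def plancherelDensity (q : ℕ) (s : ℝ) : ℝ :=
  Real.log q / Real.pi * ((1 - phase q s ^ 2) * geomKernel q s).re

theorem continuous_plancherelDensity (hq : 2 ≤ q) : Continuous (plancherelDensity q) := by
  unfold plancherelDensity
  exact continuous_const.mul (Complex.continuous_re.comp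
    ((continuous_const.sub (continuous_phase.pow 2)).mul (continuous_geomKernel hq)))

theorem phase_sq_ne_one (hq : 2 ≤ q) {s : ℝ} (h0 : 0 < s) (h1 : s < tau q) :
    phase q s ^ 2 ≠ 1 := by
  intro h
  have hl := log_pos hq
  have h3 : (phase q s ^ 2).re = 1 := by rw [h, Complex.one_re]
  rw [phase_pow_re] at h3
  push_cast at h3
  rw [Real.cos_two_mul] at h3
  have h5 := Real.sin_sq_add_cos_sq (s * Real.log q)
  have h4 : 0 < Real.sin (s * Real.log q) := by
    apply Real.sin_pos_of_pos_of_lt_pi (by positivity)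
    rw [tau, lt_div_iff₀ hl] at h1
    exact h1
  nlinarith

/-- The function `c` on the real line, in terms of `w = q ^ {i s}`. -/
theorem cFunction_eq (hq : 2 ≤ q) (s : ℝ) :
    cFunction q s = (q * phase q s - (phase q s)⁻¹) / ((q + 1) * (phase q s - (phase q s)⁻¹)) := by
  have hq0 : (q : ℂ) ≠ 0 := by
    norm_cast
    omega
  have hr : ((√q : ℝ) : ℂ) * (√q : ℝ) = q := by
    rw [← Complex.ofReal_mul, Real.mul_self_sqrt (by positivity)]
    simp
  have hr0 : ((√q : ℝ) : ℂ) ≠ 0 := fun h => hq0 (by rw [← hr, h, zero_mul])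
  have e1 : (q : ℂ) ^ (1 / 2 + Complex.I * (s : ℂ)) = (√q : ℝ) * phase q s := by
    rw [Complex.cpow_add _ _ hq0, cpow_I_mul hq, cpow_half]
  have e2 : (q : ℂ) ^ (-(1 / 2) - Complex.I * (s : ℂ)) = ((√q : ℝ) * phase q s)⁻¹ := by
    rw [← e1, ← Complex.cpow_neg]
    congr 1
    ring
  rw [cFunction, e1, e2, cpow_half, Complex.cpow_neg, cpow_I_mul hq, div_mul_div_comm, mul_sub,
    ← mul_assoc, hr, mul_inv, ← mul_assoc, mul_inv_cancel₀ hr0, one_mul]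

theorem conj_cFunction (hq : 2 ≤ q) (s : ℝ) :
    conj (cFunction q s) =
      (q * (phase q s)⁻¹ - phase q s) / ((q + 1) * ((phase q s)⁻¹ - phase q s)) := by
  rw [cFunction_eq hq]
  simp only [map_div₀, map_mul, map_sub, map_inv₀, map_add, conj_phase, inv_inv, map_natCast,
    map_one]

/-- `1 / c(-s)` is a polynomial in `w` times the geometric kernel, so it has no singularity. -/
theorem inv_conj_cFunction (hq : 2 ≤ q) {s : ℝ} (hs : phase q s ^ 2 ≠ 1) :
    (conj (cFunction q s))⁻¹ = (q + 1) / q * ((1 - phase q s ^ 2) * geomKernel q s) := by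
  have hq0 : (q : ℂ) ≠ 0 := by
    norm_cast
    omega
  have hw := phase_ne_zero (q := q) s
  have h0 := one_sub_phase_ne_zero hq s
  rw [conj_cFunction hq, geomKernel]
  have e1 : (q : ℂ) * (phase q s)⁻¹ - phase q s = (phase q s)⁻¹ * q * (1 - phase q s ^ 2 / q) := by
    field_simp
  have e2 : (phase q s)⁻¹ - phase q s = (phase q s)⁻¹ * (1 - phase q s ^ 2) := by
    field_simp
  rw [e1, e2]
  field_simp

theorem cFunction_ne_zero (hq : 2 ≤ q) {s : ℝ} (hs : phase q s ^ 2 ≠ 1) : cFunction q s ≠ 0 := by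
  intro h
  have h1 := inv_conj_cFunction hq hs
  rw [h, map_zero, inv_zero, eq_comm, mul_eq_zero, mul_eq_zero, div_eq_zero_iff] at h1
  have hq0 : (q : ℂ) ≠ 0 := by
    norm_cast
    omega
  have hq1 : (q : ℂ) + 1 ≠ 0 := by
    norm_cast
  have h2 : geomKernel q s ≠ 0 := inv_ne_zero (one_sub_phase_ne_zero hq s)
  have h3 : 1 - phase q s ^ 2 ≠ 0 := sub_ne_zero.2 (Ne.symm hs)
  tauto

theorem cFunction_add_conj (hq : 2 ≤ q) {s : ℝ} (hs : phase q s ^ 2 ≠ 1) :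
    cFunction q s + conj (cFunction q s) = 1 := by
  have hw := phase_ne_zero (q := q) s
  have hq1 : (q : ℂ) + 1 ≠ 0 := by
    norm_cast
  have h3 : phase q s ^ 2 - 1 ≠ 0 := sub_ne_zero.2 hs
  have e2 : (phase q s)⁻¹ - phase q s = -((phase q s)⁻¹ * (phase q s ^ 2 - 1)) := by
    field_simp
    ring
  have e1 : phase q s - (phase q s)⁻¹ = (phase q s)⁻¹ * (phase q s ^ 2 - 1) := by
    field_simp
  rw [conj_cFunction hq, cFunction_eq hq, e1, e2]
  field_simp
  ring

/-- The spherical function `q ^ {-d/2} (c(s) w ^ d + c(-s) w ^ {-d})` at distance `d`. -/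
noncomputable def spherical (q : ℕ) (s : ℝ) (d : ℕ) : ℂ :=
  ((√q : ℝ) ^ d : ℂ)⁻¹ * (cFunction q s * phase q s ^ d + conj (cFunction q s * phase q s ^ d))

theorem conj_spherical (s : ℝ) (d : ℕ) : conj (spherical q s d) = spherical q s d := by
  simp only [spherical, map_mul, map_add, map_inv₀, map_pow, Complex.conj_conj, Complex.conj_ofReal]
  ring

theorem spherical_zero (hq : 2 ≤ q) {s : ℝ} (hs : phase q s ^ 2 ≠ 1) : spherical q s 0 = 1 := by
  simp [spherical, cFunction_add_conj hq hs]

/-- The recursion of the spherical functions, in the shape in which it arises from the step to a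
child on the tree. -/
theorem spherical_succ (hq : 2 ≤ q) {s : ℝ} (hs : phase q s ^ 2 ≠ 1) (d : ℕ) :
    spherical q s (d + 1) = (waveBase q s)⁻¹ * spherical q s d +
      q / (q + 1) * (1 - (waveBase q s ^ 2)⁻¹) * (conj (waveBase q s) ^ (d + 1))⁻¹ := by
  have hq0 : (q : ℂ) ≠ 0 := by
    norm_cast
    omega
  have hr : ((√q : ℝ) : ℂ) ^ 2 = q := by
    rw [← Complex.ofReal_pow, Real.sq_sqrt (by positivity)]
    simp
  have hr0 : ((√q : ℝ) : ℂ) ≠ 0 := fun h => hq0 (by rw [← hr, h, zero_pow two_ne_zero])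
  have hw := phase_ne_zero (q := q) s
  have hq1 : (q : ℂ) + 1 ≠ 0 := by
    norm_cast
  have h3 : phase q s ^ 2 - 1 ≠ 0 := sub_ne_zero.2 hs
  have e1 : phase q s - (phase q s)⁻¹ = (phase q s)⁻¹ * (phase q s ^ 2 - 1) := by
    field_simp
  simp only [spherical, map_mul, map_pow, conj_waveBase, conj_phase]
  have hconj : conj (cFunction q s) = 1 - cFunction q s := by
    rw [← cFunction_add_conj hq hs]
    ring
  have hc : cFunction q s * (phase q s - (phase q s)⁻¹) =
      q / (q + 1) * (1 - (q * phase q s ^ 2)⁻¹) * phase q s := by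
    rw [cFunction_eq hq, e1]
    field_simp
  rw [hconj, waveBase, mul_pow, hr]
  simp only [pow_succ _ d, mul_pow, inv_pow, mul_inv, inv_inv]
  simp only [mul_inv] at hc
  linear_combination (((√q : ℝ) : ℂ) ^ d)⁻¹ * ((√q : ℝ) : ℂ)⁻¹ * phase q s ^ d * hc

/-- Multiplication by `|c(s)|⁻²` turns `c(s)` and `c(-s)` into `1 / c(-s)` and its conjugate, which
have no singularities. -/
theorem plancherelConst_mul_eq (hq : 2 ≤ q) {s : ℝ} (hs : phase q s ^ 2 ≠ 1) (d : ℕ) :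
    ((plancherelConst q * (‖cFunction q s‖ ^ 2)⁻¹ : ℝ) : ℂ) *
        (cFunction q s * phase q s ^ d + conj (cFunction q s * phase q s ^ d)) =
      (Real.log q / Real.pi *
        (phase q s ^ d * ((1 - phase q s ^ 2) * geomKernel q s)).re : ℝ) := by
  have hq0 : (q : ℂ) ≠ 0 := by
    norm_cast
    omega
  have hq1 : (q : ℂ) + 1 ≠ 0 := by
    norm_cast
  have hpi : (Real.pi : ℂ) ≠ 0 := by
    exact_mod_cast Real.pi_ne_zero
  have hc := cFunction_ne_zero hq hs
  have hc' : conj (cFunction q s) ≠ 0 := by simpa using hc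
  have h1 : ((‖cFunction q s‖ ^ 2 : ℝ) : ℂ) = cFunction q s * conj (cFunction q s) := by
    rw [Complex.mul_conj, Complex.normSq_eq_norm_sq]
  have h2 := inv_conj_cFunction hq hs
  have h3 : (1 - phase q s ^ 2) * geomKernel q s = q / (q + 1) * (conj (cFunction q s))⁻¹ := by
    rw [h2]
    field_simp
  have h4 : ∀ z : ℂ, ((z.re : ℝ) : ℂ) = (z + conj z) / 2 := fun z => by
    rw [Complex.add_conj]
    push_cast
    ring
  rw [Complex.ofReal_mul, Complex.ofReal_inv, h1, Complex.ofReal_mul, h4, h3, plancherelConst]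
  simp only [map_mul, map_div₀, map_inv₀, map_add, map_one, map_natCast, Complex.conj_conj, map_pow]
  push_cast
  field_simp

theorem plancherelDensity_eq (hq : 2 ≤ q) {s : ℝ} (hs : phase q s ^ 2 ≠ 1) :
    plancherelConst q * (‖cFunction q s‖ ^ 2)⁻¹ = plancherelDensity q s := by
  have h := plancherelConst_mul_eq hq hs 0
  simp only [pow_zero, mul_one, one_mul, cFunction_add_conj hq hs] at h
  exact_mod_cast h

theorem plancherelConst_pos (hq : 2 ≤ q) : 0 < plancherelConst q := by
  have := log_pos hq
  have := Real.pi_pos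
  unfold plancherelConst
  positivity

theorem ae_phase_sq_ne_one (hq : 2 ≤ q) :
    ∀ᵐ s : Spectrum q ∂(Measure.comap ((↑) : Spectrum q → ℝ) volume), phase q s ^ 2 ≠ 1 := by
  have h : ∀ᵐ s : ℝ ∂(volume.restrict (Set.Icc 0 (tau q))), phase q s ^ 2 ≠ 1 := by
    rw [← restrict_Ioo_eq_restrict_Icc]
    filter_upwards [ae_restrict_mem measurableSet_Ioo] with s hs
    exact phase_sq_ne_one hq hs.1 hs.2
  exact (ae_restrict_iff_subtype measurableSet_Icc).1 h

theorem plancherelMeasure_eq (hq : 2 ≤ q) :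
    plancherelMeasure q = (Measure.comap ((↑) : Spectrum q → ℝ) volume).withDensity
      fun s => ENNReal.ofReal (plancherelDensity q s) := by
  refine withDensity_congr_ae ?_
  filter_upwards [ae_phase_sq_ne_one hq] with s hs
  rw [plancherelDensity_eq hq hs]

theorem ae_plancherelMeasure (hq : 2 ≤ q) :
    ∀ᵐ s : Spectrum q ∂plancherelMeasure q, phase q s ^ 2 ≠ 1 :=
  (withDensity_absolutelyContinuous _ _).ae_le (ae_phase_sq_ne_one hq)

theorem integral_plancherelMeasure (hq : 2 ≤ q) (f : ℝ → ℂ) :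
    ∫ s : Spectrum q, f s ∂plancherelMeasure q =
      ∫ s in (0 : ℝ)..tau q, (plancherelDensity q s : ℂ) * f s := by
  have hm : Measurable fun s : Spectrum q => ENNReal.ofReal (plancherelDensity q s) :=
    ((continuous_plancherelDensity hq).measurable.comp measurable_subtype_coe).ennreal_ofReal
  rw [plancherelMeasure_eq hq, integral_withDensity_eq_integral_toReal_smul hm
    (Eventually.of_forall fun _ => ENNReal.ofReal_lt_top)]
  rw [intervalIntegral.integral_of_le (tau_pos hq).le, ← integral_Icc_eq_integral_Ioc,
    ← integral_subtype_comap measurableSet_Icc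
      fun s => (plancherelDensity q s : ℂ) * f s]
  refine integral_congr_ae ?_
  filter_upwards [ae_phase_sq_ne_one hq] with s hs
  have h0 : 0 ≤ plancherelDensity q s := by
    rw [← plancherelDensity_eq hq hs]
    have := plancherelConst_pos hq
    positivity
  rw [ENNReal.toReal_ofReal h0, Complex.real_smul]

/-- The integral is the difference of the cosine coefficients of order `d` and `d + 2` of the
geometric kernel. -/
theorem integral_spherical (hq : 2 ≤ q) (d : ℕ) :
    ∫ s : Spectrum q, spherical q s d ∂plancherelMeasure q = if d = 0 then 1 else 0 := by
  rw [integral_plancherelMeasure hq fun s => spherical q s d]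
  have hg := continuous_geomKernel hq
  have hp := continuous_phase (q := q)
  have h1 : ∫ s in (0 : ℝ)..tau q, (plancherelDensity q s : ℂ) * spherical q s d =
      ∫ s in (0 : ℝ)..tau q, (((√q ^ d)⁻¹ * (Real.log q / Real.pi) *
        ((phase q s ^ d * geomKernel q s).re - (phase q s ^ (d + 2) * geomKernel q s).re) : ℝ) : ℂ) := by
    rw [intervalIntegral.integral_of_le (tau_pos hq).le, integral_Ioc_eq_integral_Ioo,
      intervalIntegral.integral_of_le (tau_pos hq).le, integral_Ioc_eq_integral_Ioo]
    refine setIntegral_congr_fun measurableSet_Ioo fun s hs => ?_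
    have hs' := phase_sq_ne_one hq hs.1 hs.2
    rw [← plancherelDensity_eq hq hs', spherical, mul_left_comm, plancherelConst_mul_eq hq hs',
      ← Complex.sub_re, mul_assoc, Complex.ofReal_mul ((√q ^ d)⁻¹)]
    push_cast
    ring_nf
  have hint : ∀ k, IntervalIntegrable (fun s => (phase q s ^ k * geomKernel q s).re)
      volume 0 (tau q) := fun k =>
    (Complex.continuous_re.comp ((hp.pow k).mul hg)).intervalIntegrable _ _
  rw [h1, intervalIntegral.integral_ofReal, intervalIntegral.integral_const_mul,
    intervalIntegral.integral_sub (hint _) (hint _),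
    integral_phase_geomKernel hq, integral_phase_geomKernel hq, if_neg (by omega : d + 2 ≠ 0)]
  have hl := (log_pos hq).ne'
  have := Real.pi_ne_zero
  split_ifs with h
  · subst h
    rw [tau]
    norm_cast
    field_simp
    simp
  · simp

theorem isFiniteMeasure_plancherelMeasure (hq : 2 ≤ q) : IsFiniteMeasure (plancherelMeasure q) := by
  have hfin : IsFiniteMeasure (Measure.comap ((↑) : Spectrum q → ℝ) volume) := by
    refine ⟨?_⟩
    rw [MeasurableEmbedding.comap_apply (MeasurableEmbedding.subtype_coe measurableSet_Icc),
      Set.image_univ, Subtype.range_coe]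
    exact measure_Icc_lt_top
  rw [plancherelMeasure_eq hq]
  refine isFiniteMeasure_withDensity_ofReal ?_
  refine Integrable.hasFiniteIntegral ?_
  refine Continuous.integrable_of_hasCompactSupport
    ((continuous_plancherelDensity hq).comp continuous_subtype_val) ?_
  exact HasCompactSupport.of_compactSpace _

end PlancherelMeasure

/-! ### Orthonormality of the waves -/

section Orthonormal

variable {V : Type*} {G : SimpleGraph V} {o : V} {q : ℕ} {ν : Measure (Boundary G o)}

theorem IsBoundaryMeasure.real_cylinder (hν : IsBoundaryMeasure q ν) {x : V} (hx : x ≠ o) :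
    ν.real (cylinder G o x) = q / ((q + 1) * q ^ G.dist o x) := by
  rw [Measure.real, hν.2 x hx]
  simp [ENNReal.toReal_div, ENNReal.toReal_mul, ENNReal.toReal_add]

theorem IsBoundaryMeasure.cylinder_nonempty (hq : 2 ≤ q) (hν : IsBoundaryMeasure q ν) {x : V}
    (hx : x ≠ o) : (cylinder G o x).Nonempty := by
  rw [Set.nonempty_iff_ne_empty]
  intro h
  have h1 := hν.real_cylinder hx
  rw [h, measureReal_empty] at h1
  have : (0 : ℝ) < q / ((q + 1) * q ^ G.dist o x) := by positivity
  linarith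

theorem integrable_comp_height (hG : G.IsTree) [IsFiniteMeasure ν] (f : ℤ → ℂ) (x : V) :
    Integrable (fun ω => f (height ω x)) ν := by
  obtain ⟨C, hC⟩ := ((Finset.Icc (-(G.dist o x : ℤ)) (G.dist o x)).image fun n => ‖f n‖).bddAbove
  refine Integrable.of_bound ((measurable_from_top (f := f)).comp
    (measurable_height hG x)).aestronglyMeasurable C (Eventually.of_forall fun ω => hC ?_)
  rw [Finset.coe_image]
  refine ⟨_, ?_, rfl⟩
  rw [Finset.coe_Icc, Set.mem_Icc, ← abs_le]
  exact abs_height_le ω x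

theorem integrable_comp_height_mul (hG : G.IsTree) [IsFiniteMeasure ν] (f g : ℤ → ℂ) (x y : V) :
    Integrable (fun ω => f (height ω x) * g (height ω y)) ν := by
  obtain ⟨C, hC⟩ := ((Finset.Icc (-(G.dist o x : ℤ)) (G.dist o x)).image fun n => ‖f n‖).bddAbove
  refine (integrable_comp_height hG g y).bdd_mul (c := C)
    ((measurable_from_top (f := f)).comp
    (measurable_height hG x)).aestronglyMeasurable (Eventually.of_forall fun ω => hC ?_)
  rw [Finset.coe_image]
  refine ⟨_, ?_, rfl⟩
  rw [Finset.coe_Icc, Set.mem_Icc, ← abs_le]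
  exact abs_height_le ω x

/-- The Poisson kernel `q ^ h_ω(x)` has integral one. -/
theorem integral_natCast_zpow_height (hq : 2 ≤ q) (hG : G.IsTree) (hν : IsBoundaryMeasure q ν)
    (x : V) : ∫ ω, (q : ℂ) ^ height ω x ∂ν = 1 := by
  classical
  have := hν.1
  have hq0 : (q : ℂ) ≠ 0 := by
    norm_cast
    omega
  have hq1 : (q : ℂ) + 1 ≠ 0 := by
    norm_cast
  induction x using tree_induction (o := o) hG with
  | root => simp [height_root]
  | child u x hux hd ih =>
    have hx : x ≠ o := by
      rintro rfl
      rw [SimpleGraph.dist_self] at hd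
      omega
    simp_rw [zpow_height_child hG hux hd _ hq0]
    rw [integral_add ((integrable_comp_height hG (fun n => (q : ℂ) ^ n) u).const_mul _),
      integral_const_mul, ih]
    · have : ∀ ω, (if ω ∈ cylinder G o x then
          (q : ℂ) ^ (G.dist o x : ℤ) * (1 - ((q : ℂ) ^ 2)⁻¹) else 0) =
          (cylinder G o x).indicator
            (fun _ => (q : ℂ) ^ (G.dist o x : ℤ) * (1 - ((q : ℂ) ^ 2)⁻¹)) ω := fun ω => rfl
      simp_rw [this]
      rw [integral_indicator_const _ (measurableSet_cylinder x), hν.real_cylinder hx,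
        Complex.real_smul]
      push_cast
      rw [zpow_natCast]
      field_simp
      ring
    · exact (integrable_const _).indicator (measurableSet_cylinder x)

/-- If `y` does not lie behind `x`, the parent of `x` is closer to `y` than `x`. -/
theorem dist_eq_dist_parent_add_one (hq : 2 ≤ q) (hG : G.IsTree) (hν : IsBoundaryMeasure q ν)
    {u x y : V} (hux : G.Adj u x) (hd : G.dist o x = G.dist o u + 1)
    (hy : G.dist o x + G.dist x y ≠ G.dist o y) : G.dist x y = G.dist u y + 1 := by
  have hx : x ≠ o := by
    rintro rfl
    rw [SimpleGraph.dist_self] at hd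
    omega
  obtain ⟨ω, hω⟩ := hν.cylinder_nonempty hq hx
  have h1 := height_eq_of_mem_cylinder hG hω hy
  have hsymm : ∀ a b : V, G.dist a b = G.dist b a := fun a b => SimpleGraph.dist_comm
  have h2 := hG.dist_eq_dist_add_one_of_adj y hux
  rw [hsymm y, hsymm y] at h2
  by_cases h : G.dist o u + G.dist u y = G.dist o y
  · omega
  · have h3 := height_eq_of_mem_cylinder hG (mem_cylinder_parent hG hux hd hω) h
    omega

/-- The integral over the boundary of a product of two waves is a spherical function of the
distance of the two vertices. -/
theorem integral_zpow_height_mul (hq : 2 ≤ q) (hG : G.IsTree) (hν : IsBoundaryMeasure q ν)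
    {s : ℝ} (hs : phase q s ^ 2 ≠ 1) (x y : V) :
    ∫ ω, waveBase q s ^ height ω x * conj (waveBase q s) ^ height ω y ∂ν =
      spherical q s (G.dist x y) := by
  classical
  have := hν.1
  have hz := waveBase_ne_zero hq s
  have hz' : conj (waveBase q s) ≠ 0 := by simpa using hz
  have hzz := waveBase_mul_conj (q := q) s
  set z := waveBase q s with hzdef
  have hq0 : (q : ℂ) ≠ 0 := by
    norm_cast
    omega
  have hswap : ∀ x y, ∫ ω, z ^ height ω x * conj z ^ height ω y ∂ν =
      conj (∫ ω, z ^ height ω y * conj z ^ height ω x ∂ν) := by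
    intro x y
    rw [← integral_conj]
    congr 1
    funext ω
    simp only [map_mul, map_zpow₀, Complex.conj_conj]
    ring
  have step : ∀ u x y, G.Adj u x → G.dist o x = G.dist o u + 1 →
      G.dist o x + G.dist x y ≠ G.dist o y →
      ∫ ω, z ^ height ω u * conj z ^ height ω y ∂ν = spherical q s (G.dist u y) →
      ∫ ω, z ^ height ω x * conj z ^ height ω y ∂ν = spherical q s (G.dist x y) := by
    intro u x y hux hd hy ih
    have hx : x ≠ o := by
      rintro rfl
      rw [SimpleGraph.dist_self] at hd
      omega
    have h1 : ∀ ω, z ^ height ω x * conj z ^ height ω y =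
        z⁻¹ * (z ^ height ω u * conj z ^ height ω y) +
        (cylinder G o x).indicator (fun _ => (q : ℂ) ^ G.dist o x * (1 - (z ^ 2)⁻¹) *
          (conj z ^ G.dist x y)⁻¹) ω := by
      intro ω
      rw [zpow_height_child hG hux hd _ hz, add_mul, mul_assoc, Set.indicator]
      congr 1
      split_ifs with h
      · rw [height_eq_of_mem_cylinder hG h hy, zpow_sub₀ hz', ← hzz, mul_pow]
        simp only [zpow_natCast]
        field_simp
      · simp
    simp_rw [h1]
    rw [integral_add ((integrable_comp_height_mul hG (fun n => z ^ n) (fun n => conj z ^ n)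
      u y).const_mul _) ((integrable_const _).indicator (measurableSet_cylinder x)),
      integral_const_mul, ih, integral_indicator_const _ (measurableSet_cylinder x),
      hν.real_cylinder hx, dist_eq_dist_parent_add_one hq hG hν hux hd hy,
      spherical_succ hq hs, Complex.real_smul, ← hzdef]
    push_cast
    field_simp
  induction hn : G.dist o x + G.dist o y using Nat.strong_induction_on generalizing x y with
  | _ n ih =>
    by_cases hxy : x = y
    · subst hxy
      rw [SimpleGraph.dist_self, spherical_zero hq hs, ← integral_natCast_zpow_height hq hG hν x]
      congr 1
      funext ω
      rw [← mul_zpow, hzz]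
    · have hpos : 0 < G.dist x y := hG.connected.pos_dist_of_ne hxy
      by_cases hy : G.dist o x + G.dist x y = G.dist o y
      · obtain ⟨m, hm⟩ := Nat.exists_eq_succ_of_ne_zero (n := G.dist o y) (by omega)
        obtain ⟨u, hu, hum⟩ := exists_parent hG hm
        rw [hswap, step u y x hu (by omega) (by rw [G.dist_comm (u := y)]; omega)
          (ih (G.dist o u + G.dist o x) (by omega) u x rfl), conj_spherical, SimpleGraph.dist_comm]
      · have h0 : G.dist o x ≠ 0 := by
          intro h
          have hox := hG.connected.dist_eq_zero_iff.1 h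
          rw [← hox] at hy
          simp at hy
        obtain ⟨m, hm⟩ := Nat.exists_eq_succ_of_ne_zero h0
        obtain ⟨u, hu, hum⟩ := exists_parent hG hm
        exact step u x y hu (by omega) hy (ih (G.dist o u + G.dist o y) (by omega) u y rfl)

theorem isProbabilityMeasure_plancherelMeasure (hq : 2 ≤ q) :
    IsProbabilityMeasure (plancherelMeasure q) := by
  have := isFiniteMeasure_plancherelMeasure hq
  have h := integral_spherical hq 0
  have h1 : ∀ᵐ s : Spectrum q ∂plancherelMeasure q, spherical q s 0 = 1 := by
    filter_upwards [ae_plancherelMeasure hq] with s hs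
    exact spherical_zero hq hs
  rw [integral_congr_ae h1] at h
  simp only [integral_const, Complex.real_smul, mul_one, if_true] at h
  refine ⟨(ENNReal.toReal_eq_one_iff _).1 ?_⟩
  exact_mod_cast h

theorem isProbabilityMeasure_spectralMeasure (hq : 2 ≤ q) (hG : G.IsTree)
    (hreg : ∀ v, (G.neighborSet v).ncard = q + 1) :
    IsProbabilityMeasure (spectralMeasure G o q) := by
  have := (isBoundaryMeasure_boundaryMeasure (o := o) hG hq hreg).1
  have := isProbabilityMeasure_plancherelMeasure hq
  unfold spectralMeasure
  infer_instance

theorem memLp_top_wavePlus (hq : 2 ≤ q) (hG : G.IsTree) (x : V) :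
    MemLp (wavePlus q x) ∞ (spectralMeasure G o q) :=
  memLp_top_of_bound (measurable_wavePlus hG x).aestronglyMeasurable _
    (Eventually.of_forall (norm_wavePlus_le hq x))

theorem memLp_top_waveMinus (hq : 2 ≤ q) (hG : G.IsTree) (x : V) :
    MemLp (waveMinus q x) ∞ (spectralMeasure G o q) :=
  memLp_top_of_bound (measurable_waveMinus hq hG x).aestronglyMeasurable _
    (Eventually.of_forall (norm_waveMinus_le hq x))

/-- The Plancherel formula: the waves form an orthonormal system. -/
theorem integral_wavePlus_mul_waveMinus [DecidableEq V] (hq : 2 ≤ q) (hG : G.IsTree)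
    (hreg : ∀ v, (G.neighborSet v).ncard = q + 1) (x y : V) :
    ∫ p, wavePlus q x p * waveMinus q y p ∂spectralMeasure G o q = if x = y then 1 else 0 := by
  have hν := isBoundaryMeasure_boundaryMeasure (o := o) hG hq hreg
  have := hν.1
  have := isFiniteMeasure_plancherelMeasure hq
  have := isProbabilityMeasure_spectralMeasure (o := o) hq hG hreg
  have hint : Integrable (fun p => wavePlus q x p * waveMinus q y p) (spectralMeasure G o q) :=
    ((memLp_top_waveMinus hq hG y).integrable le_top).bdd_mul
      (measurable_wavePlus hG x).aestronglyMeasurable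
      (Eventually.of_forall (norm_wavePlus_le hq x))
  rw [spectralMeasure] at hint ⊢
  rw [integral_prod_symm _ hint]
  have h1 : ∀ᵐ s : Spectrum q ∂plancherelMeasure q,
      ∫ ω, wavePlus q x (ω, s) * waveMinus q y (ω, s) ∂boundaryMeasure G o q =
        spherical q s (G.dist x y) := by
    filter_upwards [ae_plancherelMeasure hq] with s hs
    simp_rw [wavePlus_eq hq, waveMinus_eq hq]
    exact integral_zpow_height_mul hq hG hν hs x y
  rw [integral_congr_ae h1, integral_spherical hq]
  simp only [hG.connected.dist_eq_zero_iff]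

end Orthonormal

/-! ### The transform on finitely supported and on square summable functions -/

section L2Transform

variable {V : Type*} {G : SimpleGraph V} {o : V} {q : ℕ}

theorem helgason_eq_sum {φ : V → ℂ} {S : Finset V} (hS : φ.support ⊆ S)
    (p : Boundary G o × Spectrum q) : helgason q φ p = ∑ y ∈ S, φ y * wavePlus q y p := by
  refine tsum_eq_sum fun y hy => ?_
  rw [Function.notMem_support.1 fun h => hy (hS h), zero_mul]

theorem memLp_top_helgason (hq : 2 ≤ q) (hG : G.IsTree) {φ : V → ℂ} (hφ : φ.support.Finite) :
    MemLp (helgason q φ) ∞ (spectralMeasure G o q) := by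
  have : (helgason q φ : Boundary G o × Spectrum q → ℂ) =
      fun p => ∑ y ∈ hφ.toFinset, φ y * wavePlus q y p :=
    funext fun p => helgason_eq_sum (by simp) p
  rw [this]
  exact memLp_finsetSum _ fun y _ => (memLp_top_wavePlus hq hG y).const_mul _

theorem integrable_mul_wavePlus (hq : 2 ≤ q) (hG : G.IsTree)
    {h : Boundary G o × Spectrum q → ℂ} (hh : Integrable h (spectralMeasure G o q)) (y : V) :
    Integrable (fun p => h p * wavePlus q y p) (spectralMeasure G o q) :=
  hh.mul_bdd (measurable_wavePlus hG y).aestronglyMeasurable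
    (Eventually.of_forall (norm_wavePlus_le hq y))

theorem integrable_mul_helgason (hq : 2 ≤ q) (hG : G.IsTree)
    {h : Boundary G o × Spectrum q → ℂ} (hh : Integrable h (spectralMeasure G o q))
    {φ : V → ℂ} (hφ : φ.support.Finite) :
    Integrable (fun p => h p * helgason q φ p) (spectralMeasure G o q) := by
  have h1 := (memLp_one_iff_integrable.2 hh).mul (r := 1) (memLp_top_helgason hq hG hφ)
  refine (memLp_one_iff_integrable.1 h1).congr (Eventually.of_forall fun p => ?_)
  simp [mul_comm]

theorem integral_mul_helgason (hq : 2 ≤ q) (hG : G.IsTree)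
    {h : Boundary G o × Spectrum q → ℂ} (hh : Integrable h (spectralMeasure G o q))
    {φ : V → ℂ} {S : Finset V} (hS : φ.support ⊆ S) :
    ∫ p, h p * helgason q φ p ∂spectralMeasure G o q =
      ∑ y ∈ S, φ y * ∫ p, h p * wavePlus q y p ∂spectralMeasure G o q := by
  simp_rw [helgason_eq_sum hS, Finset.mul_sum]
  rw [integral_finsetSum _ fun y _ => ?_]
  · refine Finset.sum_congr rfl fun y _ => ?_
    rw [← integral_const_mul]
    congr 1
    funext p
    ring
  · have := (integrable_mul_wavePlus hq hG hh y).const_mul (φ y)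
    refine this.congr (Eventually.of_forall fun p => ?_)
    simp only
    ring

theorem helgasonPairing_eq_sum {φ g : V → ℂ} {S : Finset V} (hS : φ.support ⊆ S) :
    helgasonPairing φ g = ∑ y ∈ S, φ y * conj (g y) := by
  refine tsum_eq_sum fun y hy => ?_
  rw [Function.notMem_support.1 fun h => hy (hS h), zero_mul]

/-- If `F` is an integrable transform of `g`, the pairing of `F` with the transform of a finitely
supported function is given by the Plancherel formula. -/
theorem IsL1Transform.integral_conj_mul_helgason (hq : 2 ≤ q) (hG : G.IsTree) {g : V → ℂ}
    {F : Boundary G o × Spectrum q → ℂ} (hF : IsL1Transform q g F) {φ : V → ℂ}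
    (hφ : φ.support.Finite) :
    ∫ p, conj (F p) * helgason q φ p ∂spectralMeasure G o q = helgasonPairing φ g := by
  have hint : Integrable (fun p => conj (F p)) (spectralMeasure G o q) :=
    (Complex.conjLIE.integrable_comp_iff).2 hF.1
  have hS : φ.support ⊆ (hφ.toFinset : Set V) := by simp
  rw [integral_mul_helgason hq hG hint hS, helgasonPairing_eq_sum hS]
  refine Finset.sum_congr rfl fun y _ => ?_
  rw [← hF.2 y, ← integral_conj]
  congr 2
  funext p
  rw [map_mul, conj_waveMinus hq, mul_comm]

/-- The transform of a finitely supported function is also its transform in the sense of the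
inversion formula. -/
theorem isL1Transform_helgason (hq : 2 ≤ q) (hG : G.IsTree)
    (hreg : ∀ v, (G.neighborSet v).ncard = q + 1) {φ : V → ℂ} (hφ : φ.support.Finite) :
    IsL1Transform q φ (helgason q φ : Boundary G o × Spectrum q → ℂ) := by
  classical
  have := isProbabilityMeasure_spectralMeasure (o := o) hq hG hreg
  refine ⟨(memLp_top_helgason hq hG hφ).integrable le_top, fun y => ?_⟩
  have hS : φ.support ⊆ (hφ.toFinset : Set V) := by simp
  rw [integral_mul_helgason hq hG ((memLp_top_waveMinus hq hG y).integrable le_top) hS]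
  simp_rw [mul_comm (waveMinus q y _), integral_wavePlus_mul_waveMinus hq hG hreg]
  simp only [mul_ite, mul_one, mul_zero, Finset.sum_ite_eq', Set.Finite.mem_toFinset,
    Function.mem_support]
  split_ifs with h
  · rfl
  · exact (not_not.1 h).symm

/-- The wave of a vertex, as a vector of `L²(ν × μ)`. -/
noncomputable def waveL2 (hq : 2 ≤ q) (hG : G.IsTree)
    (hreg : ∀ v, (G.neighborSet v).ncard = q + 1) (x : V) : Lp ℂ 2 (spectralMeasure G o q) :=
  have := isProbabilityMeasure_spectralMeasure (o := o) hq hG hreg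
  ((memLp_top_wavePlus hq hG x).mono_exponent le_top).toLp

theorem coeFn_waveL2 (hq : 2 ≤ q) (hG : G.IsTree)
    (hreg : ∀ v, (G.neighborSet v).ncard = q + 1) (x : V) :
    waveL2 (o := o) hq hG hreg x =ᵐ[spectralMeasure G o q] wavePlus q x :=
  have := isProbabilityMeasure_spectralMeasure (o := o) hq hG hreg
  ((memLp_top_wavePlus hq hG x).mono_exponent le_top).coeFn_toLp

theorem inner_waveL2_left (hq : 2 ≤ q) (hG : G.IsTree)
    (hreg : ∀ v, (G.neighborSet v).ncard = q + 1) (y : V) (F : Lp ℂ 2 (spectralMeasure G o q)) :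
    inner ℂ (waveL2 hq hG hreg y) F = ∫ p, waveMinus q y p * F p ∂spectralMeasure G o q := by
  rw [L2.inner_def]
  refine integral_congr_ae ?_
  filter_upwards [coeFn_waveL2 (o := o) hq hG hreg y] with p hp
  rw [RCLike.inner_apply, hp, mul_comm]
  congr 1
  exact conj_wavePlus hq y p

theorem orthonormal_waveL2 (hq : 2 ≤ q) (hG : G.IsTree)
    (hreg : ∀ v, (G.neighborSet v).ncard = q + 1) :
    Orthonormal ℂ (waveL2 (o := o) hq hG hreg) := by
  classical
  rw [orthonormal_iff_ite]
  intro x y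
  rw [inner_waveL2_left]
  have h := integral_wavePlus_mul_waveMinus (o := o) hq hG hreg y x
  simp only [eq_comm (a := x)]
  rw [← h]
  refine integral_congr_ae ?_
  filter_upwards [coeFn_waveL2 (o := o) hq hG hreg y] with p hp
  rw [hp, mul_comm]

/-- The extension of the transform to an isometry on `L²(𝔛)`. -/
noncomputable def plancherelIsometry (hq : 2 ≤ q) (hG : G.IsTree)
    (hreg : ∀ v, (G.neighborSet v).ncard = q + 1) :
    lp (fun _ : V => ℂ) 2 →ₗᵢ[ℂ] Lp ℂ 2 (spectralMeasure G o q) :=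
  (orthonormal_waveL2 hq hG hreg).orthogonalFamily.linearIsometry

theorem hasSum_plancherelIsometry (hq : 2 ≤ q) (hG : G.IsTree)
    (hreg : ∀ v, (G.neighborSet v).ncard = q + 1) (g : lp (fun _ : V => ℂ) 2) :
    HasSum (fun y => g y • waveL2 (o := o) hq hG hreg y) (plancherelIsometry hq hG hreg g) := by
  have h := (orthonormal_waveL2 (o := o) hq hG hreg).orthogonalFamily.hasSum_linearIsometry g
  simp only [LinearIsometry.toSpanSingleton_apply] at h
  exact h

theorem inner_waveL2_plancherelIsometry (hq : 2 ≤ q) (hG : G.IsTree)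
    (hreg : ∀ v, (G.neighborSet v).ncard = q + 1) (g : lp (fun _ : V => ℂ) 2) (y : V) :
    inner ℂ (waveL2 (o := o) hq hG hreg y) (plancherelIsometry hq hG hreg g) = g y := by
  classical
  have h := (hasSum_plancherelIsometry (o := o) hq hG hreg g).mapL
    (innerSL ℂ (waveL2 (o := o) hq hG hreg y))
  have h2 : ∀ x, innerSL ℂ (waveL2 (o := o) hq hG hreg y) (g x • waveL2 (o := o) hq hG hreg x) =
      if x = y then g y else 0 := by
    intro x
    rw [map_smul, innerSL_apply_apply,
      orthonormal_iff_ite.1 (orthonormal_waveL2 (o := o) hq hG hreg) y x]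
    split_ifs with h1 h2 h2
    · simp [h1]
    · exact absurd h1.symm h2
    · exact absurd h2.symm h1
    · simp
  simp_rw [h2] at h
  exact h.unique (hasSum_ite_eq y (g y))

theorem coeFn_sum_waveL2 (hq : 2 ≤ q) (hG : G.IsTree)
    (hreg : ∀ v, (G.neighborSet v).ncard = q + 1) (g : V → ℂ) (A : Finset V) :
    ⇑(∑ y ∈ A, g y • waveL2 (o := o) hq hG hreg y) =ᵐ[spectralMeasure G o q]
      helgason q (Set.indicator (A : Set V) g) := by
  have h1 : ∀ y, ⇑(g y • waveL2 (o := o) hq hG hreg y) =ᵐ[spectralMeasure G o q]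
      fun p => g y * wavePlus q y p := fun y => by
    filter_upwards [Lp.coeFn_smul (g y) (waveL2 (o := o) hq hG hreg y),
      coeFn_waveL2 (o := o) hq hG hreg y] with p h2 h3
    rw [h2, Pi.smul_apply, h3, smul_eq_mul]
  have h2 : ∀ᵐ p ∂spectralMeasure G o q, ∀ y ∈ A,
      (g y • waveL2 (o := o) hq hG hreg y : Lp ℂ 2 (spectralMeasure G o q)) p =
        g y * wavePlus q y p :=
    (ae_ball_iff A.countable_toSet).2 fun y _ => h1 y
  filter_upwards [Lp.coeFn_finsetSum A fun y => g y • waveL2 (o := o) hq hG hreg y, h2]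
    with p h3 h4
  rw [h3, Finset.sum_apply, helgason_eq_sum (S := A) (Set.support_indicator_subset)]
  refine Finset.sum_congr rfl fun y hy => ?_
  rw [h4 y hy, Set.indicator_of_mem (Finset.mem_coe.2 hy)]

theorem isL2Transform_plancherelIsometry (hq : 2 ≤ q) (hG : G.IsTree)
    (hreg : ∀ v, (G.neighborSet v).ncard = q + 1) (g : lp (fun _ : V => ℂ) 2) :
    IsL2Transform q g (plancherelIsometry (o := o) hq hG hreg g) := by
  refine ⟨Lp.memLp _, ?_⟩
  have h := (hasSum_plancherelIsometry (o := o) hq hG hreg g)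
  rw [HasSum, tendsto_iff_edist_tendsto_0] at h
  refine Tendsto.congr (fun A => ?_) h
  rw [edist_comm, Lp.edist_def]
  refine eLpNorm_congr_ae ?_
  filter_upwards [coeFn_sum_waveL2 (o := o) hq hG hreg g A] with p hp
  rw [Pi.sub_apply, hp]

/-- The `L²`-transform is unique up to null sets. -/
theorem IsL2Transform.toLp_eq (hq : 2 ≤ q) (hG : G.IsTree)
    (hreg : ∀ v, (G.neighborSet v).ncard = q + 1) {g : lp (fun _ : V => ℂ) 2}
    {F : Boundary G o × Spectrum q → ℂ} (hF : IsL2Transform q g F) :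
    hF.1.toLp = plancherelIsometry hq hG hreg g := by
  have h := (hasSum_plancherelIsometry (o := o) hq hG hreg g)
  refine tendsto_nhds_unique ?_ h
  rw [tendsto_iff_edist_tendsto_0]
  refine Tendsto.congr (fun A => ?_) hF.2
  rw [edist_comm, Lp.edist_def]
  refine eLpNorm_congr_ae ?_
  filter_upwards [coeFn_sum_waveL2 (o := o) hq hG hreg g A, hF.1.coeFn_toLp] with p hp hp2
  rw [Pi.sub_apply, hp, hp2]

theorem IsL2Transform.isL1Transform (hq : 2 ≤ q) (hG : G.IsTree)
    (hreg : ∀ v, (G.neighborSet v).ncard = q + 1) {g : lp (fun _ : V => ℂ) 2}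
    {F : Boundary G o × Spectrum q → ℂ} (hF : IsL2Transform q g F) : IsL1Transform q g F := by
  have := isProbabilityMeasure_spectralMeasure (o := o) hq hG hreg
  refine ⟨hF.1.integrable one_le_two, fun y => ?_⟩
  rw [← inner_waveL2_plancherelIsometry (o := o) hq hG hreg g y, ← hF.toLp_eq hq hG hreg,
    inner_waveL2_left]
  refine integral_congr_ae ?_
  filter_upwards [hF.1.coeFn_toLp] with p hp
  rw [hp]

/-- `ν × μ` is a probability measure, so the `L¹`-norm is at most the `L²`-norm, which the transform
preserves. -/
theorem IsL2Transform.integral_norm_le (hq : 2 ≤ q) (hG : G.IsTree)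
    (hreg : ∀ v, (G.neighborSet v).ncard = q + 1) {g : lp (fun _ : V => ℂ) 2}
    {F : Boundary G o × Spectrum q → ℂ} (hF : IsL2Transform q g F) :
    ∫ p, ‖F p‖ ∂spectralMeasure G o q ≤ ‖g‖ := by
  have := isProbabilityMeasure_spectralMeasure (o := o) hq hG hreg
  rw [← (plancherelIsometry (o := o) hq hG hreg).norm_map g, ← hF.toLp_eq hq hG hreg,
    Lp.norm_toLp, integral_norm_eq_lintegral_enorm hF.1.1, ← eLpNorm_one_eq_lintegral_enorm]
  exact ENNReal.toReal_mono hF.1.2.ne (eLpNorm_le_eLpNorm_of_exponent_le one_le_two hF.1.1)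

end L2Transform

/-! ### Injectivity of the inversion formula on integrable functions -/

section Injectivity

variable {V : Type*} {G : SimpleGraph V} {o : V} {q : ℕ}

/-- The integrable function `h` annihilates all waves. -/
def AnnihilatesWaves (h : Boundary G o × Spectrum q → ℂ) : Prop :=
  Integrable h (spectralMeasure G o q) ∧
    ∀ y, ∫ p, h p * wavePlus q y p ∂spectralMeasure G o q = 0

theorem integrable_continuous_mul {h : Boundary G o × Spectrum q → ℂ}
    (hh : Integrable h (spectralMeasure G o q)) (g : C(Spectrum q, ℂ)) :
    Integrable (fun p => g p.2 * h p) (spectralMeasure G o q) :=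
  hh.bdd_mul (c := ‖g‖) (g.continuous.measurable.comp measurable_snd).aestronglyMeasurable
    (Eventually.of_forall fun p => g.norm_coe_le_norm p.2)

/-- The eigenvalue of the adjacency operator, up to a factor. -/
noncomputable def cosMap (q : ℕ) : C(Spectrum q, ℝ) :=
  ⟨fun s => Real.cos (s * Real.log q), by fun_prop⟩

/-- A real continuous function, with complex values. -/
noncomputable def toComplex {X : Type*} [TopologicalSpace X] (g : C(X, ℝ)) : C(X, ℂ) :=
  ⟨fun s => (g s : ℂ), by fun_prop⟩

/-- As the waves are eigenfunctions of the adjacency operator, their annihilator is stable under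
multiplication by the eigenvalue. -/
theorem AnnihilatesWaves.cos_mul (hq : 2 ≤ q) (hG : G.IsTree)
    (hreg : ∀ v, (G.neighborSet v).ncard = q + 1) {h : Boundary G o × Spectrum q → ℂ}
    (hh : AnnihilatesWaves h) : AnnihilatesWaves fun p => toComplex (cosMap q) p.2 * h p := by
  refine ⟨integrable_continuous_mul hh.1 _, fun y => ?_⟩
  have hfin : (G.neighborSet y).Finite := Set.finite_of_ncard_ne_zero (by rw [hreg y]; omega)
  have h1 : ∀ p : Boundary G o × Spectrum q, toComplex (cosMap q) p.2 * h p * wavePlus q y p =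
      ((2 * √q : ℝ) : ℂ)⁻¹ * ∑ x ∈ hfin.toFinset, h p * wavePlus q x p := by
    intro p
    have h0 : ((2 * √q : ℝ) : ℂ) ≠ 0 := by
      norm_cast
      positivity
    rw [← Finset.mul_sum, sum_neighbor_wavePlus hq hG hreg y _ (by simp)]
    simp only [toComplex, cosMap, ContinuousMap.coe_mk]
    rw [Complex.ofReal_mul (2 * √q)]
    field_simp
  simp_rw [h1]
  rw [integral_const_mul, integral_finsetSum _ fun x _ => integrable_mul_wavePlus hq hG hh.1 x]
  simp [hh.2]

theorem separatesPoints_cosMap (hq : 2 ≤ q) :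
    (Algebra.adjoin ℝ {cosMap q}).SeparatesPoints := by
  intro s t hst
  refine ⟨_, ⟨cosMap q, Algebra.subset_adjoin rfl, rfl⟩, fun h => hst ?_⟩
  have hl := log_pos hq
  have hmem : ∀ s : Spectrum q, (s : ℝ) * Real.log q ∈ Set.Icc 0 Real.pi := by
    intro s
    refine ⟨mul_nonneg s.2.1 hl.le, ?_⟩
    exact (le_div_iff₀ hl).1 s.2.2
  have h2 := Real.injOn_cos (hmem s) (hmem t) h
  exact Subtype.ext (mul_right_cancel₀ hl.ne' h2)

theorem AnnihilatesWaves.continuous_mul (hq : 2 ≤ q) (hG : G.IsTree)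
    (hreg : ∀ v, (G.neighborSet v).ncard = q + 1) {h : Boundary G o × Spectrum q → ℂ}
    (hh : AnnihilatesWaves h) (g : C(Spectrum q, ℝ)) :
    AnnihilatesWaves fun p => toComplex g p.2 * h p := by
  have hadj : ∀ g ∈ Algebra.adjoin ℝ {cosMap q}, ∀ h : Boundary G o × Spectrum q → ℂ,
      AnnihilatesWaves h → AnnihilatesWaves fun p => toComplex g p.2 * h p := by
    intro g hg
    induction hg using Algebra.adjoin_induction with
    | mem g hg =>
      rw [Set.mem_singleton_iff.1 hg]
      exact fun h hh => hh.cos_mul hq hG hreg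
    | algebraMap r =>
      refine fun h hh => ⟨integrable_continuous_mul hh.1 _, fun y => ?_⟩
      have h1 : ∀ p : Boundary G o × Spectrum q,
          toComplex (algebraMap ℝ C(Spectrum q, ℝ) r) p.2 * h p * wavePlus q y p =
            (r : ℂ) * (h p * wavePlus q y p) := fun p => by
        simp [toComplex, mul_assoc]
      simp_rw [h1]
      rw [integral_const_mul, hh.2, mul_zero]
    | add g₁ g₂ _ _ h₁ h₂ =>
      refine fun h hh => ⟨integrable_continuous_mul hh.1 _, fun y => ?_⟩
      have h1 : ∀ p : Boundary G o × Spectrum q,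
          toComplex (g₁ + g₂) p.2 * h p * wavePlus q y p =
            toComplex g₁ p.2 * h p * wavePlus q y p + toComplex g₂ p.2 * h p * wavePlus q y p :=
        fun p => by
          simp [toComplex]
          ring
      simp_rw [h1]
      rw [integral_add (integrable_mul_wavePlus hq hG (h₁ h hh).1 y)
        (integrable_mul_wavePlus hq hG (h₂ h hh).1 y), (h₁ h hh).2, (h₂ h hh).2, add_zero]
    | mul g₁ g₂ _ _ h₁ h₂ =>
      intro h hh
      have h1 := h₁ _ (h₂ h hh)
      have h2 : (fun p : Boundary G o × Spectrum q => toComplex (g₁ * g₂) p.2 * h p) =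
          fun p => toComplex g₁ p.2 * (toComplex g₂ p.2 * h p) := by
        funext p
        simp [toComplex, mul_assoc]
      rwa [h2]
  refine ⟨integrable_continuous_mul hh.1 _, fun y => ?_⟩
  have hdense : g ∈ closure (Algebra.adjoin ℝ {cosMap q} : Set C(Spectrum q, ℝ)) := by
    have := ContinuousMap.subalgebra_topologicalClosure_eq_top_of_separatesPoints _
      (separatesPoints_cosMap hq)
    rw [← Subalgebra.topologicalClosure_coe, this]
    trivial
  obtain ⟨u, hu, hlim⟩ := mem_closure_iff_seq_limit.1 hdense
  have hlim2 : Tendsto (fun n => ∫ p, toComplex (u n) p.2 * h p * wavePlus q y p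
      ∂spectralMeasure G o q) atTop
      (𝓝 (∫ p, toComplex g p.2 * h p * wavePlus q y p ∂spectralMeasure G o q)) := by
    obtain ⟨C, hC⟩ := (Metric.isBounded_range_of_tendsto u hlim).exists_norm_le
    refine tendsto_integral_of_dominated_convergence (fun p => C * ‖h p * wavePlus q y p‖)
      (fun n => (integrable_mul_wavePlus hq hG (integrable_continuous_mul hh.1 _) y).1)
      ((integrable_mul_wavePlus hq hG hh.1 y).norm.const_mul C) (fun n => ?_) ?_
    · refine Eventually.of_forall fun p => ?_
      rw [mul_assoc, norm_mul]
      gcongr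
      refine le_trans ?_ (hC _ ⟨n, rfl⟩)
      simpa [toComplex] using (u n).norm_coe_le_norm p.2
    · refine Eventually.of_forall fun p => ?_
      have h3 : Tendsto (fun n => u n p.2) atTop (𝓝 (g p.2)) :=
        ((continuous_eval_const p.2).tendsto g).comp hlim
      have h4 := (Complex.continuous_ofReal.tendsto _).comp h3
      simp_rw [mul_assoc]
      exact h4.mul_const _
  refine tendsto_nhds_unique hlim2 ?_
  have h0 : ∀ n, ∫ p, toComplex (u n) p.2 * h p * wavePlus q y p ∂spectralMeasure G o q = 0 :=
    fun n => (hadj _ (hu n) h hh).2 y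
  simp_rw [h0]
  exact tendsto_const_nhds

theorem AnnihilatesWaves.integral_continuous_mul (hq : 2 ≤ q) (hG : G.IsTree)
    (hreg : ∀ v, (G.neighborSet v).ncard = q + 1) {h : Boundary G o × Spectrum q → ℂ}
    (hh : AnnihilatesWaves h) (g : C(Spectrum q, ℂ)) (y : V) :
    ∫ p, g p.2 * (h p * wavePlus q y p) ∂spectralMeasure G o q = 0 := by
  let gre : C(Spectrum q, ℝ) := ⟨fun s => (g s).re, by fun_prop⟩
  let gim : C(Spectrum q, ℝ) := ⟨fun s => (g s).im, by fun_prop⟩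
  have h1 : ∀ p : Boundary G o × Spectrum q, g p.2 * (h p * wavePlus q y p) =
      toComplex gre p.2 * h p * wavePlus q y p +
        Complex.I * (toComplex gim p.2 * h p * wavePlus q y p) := by
    intro p
    have h2 : g p.2 = toComplex gre p.2 + toComplex gim p.2 * Complex.I :=
      (Complex.re_add_im _).symm
    rw [h2]
    ring
  have hre := hh.continuous_mul hq hG hreg gre
  have him := hh.continuous_mul hq hG hreg gim
  simp_rw [h1]
  rw [integral_add (integrable_mul_wavePlus hq hG hre.1 y)
    ((integrable_mul_wavePlus hq hG him.1 y).const_mul _), integral_const_mul, hre.2, him.2]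
  simp

/-- The annihilator of the waves also annihilates the products of indicator functions of the sets
`E(x)` with continuous functions of `s`. -/
theorem AnnihilatesWaves.setIntegral_cylinder (hq : 2 ≤ q) (hG : G.IsTree)
    (hreg : ∀ v, (G.neighborSet v).ncard = q + 1) {h : Boundary G o × Spectrum q → ℂ}
    (hh : AnnihilatesWaves h) (g : C(Spectrum q, ℂ)) (x : V) :
    ∫ p in cylinder G o x ×ˢ Set.univ, g p.2 * h p ∂spectralMeasure G o q = 0 := by
  classical
  by_cases hx : x = o
  · subst hx
    rw [cylinder_root, Set.univ_prod_univ, Measure.restrict_univ,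
      ← hh.integral_continuous_mul hq hG hreg g x]
    congr 1
    funext p
    rw [wavePlus_eq hq, height_root]
    simp
  · obtain ⟨m, hm⟩ := Nat.exists_eq_succ_of_ne_zero (n := G.dist o x) (by
      rw [Ne, hG.connected.dist_eq_zero_iff]
      exact fun h => hx h.symm)
    obtain ⟨u, hu, hum⟩ := exists_parent hG hm
    have hd : G.dist o x = G.dist o u + 1 := by omega
    let D : ℝ → ℂ := fun s => waveBase q s ^ G.dist o x * (1 - (waveBase q s ^ 2)⁻¹)
    have hD : ∀ s, D s ≠ 0 := by
      intro s
      have hz := waveBase_ne_zero hq s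
      refine mul_ne_zero (pow_ne_zero _ hz) (sub_ne_zero.2 fun h => ?_)
      have h1 : ‖waveBase q s ^ 2‖ = 1 := by
        rw [← inv_inv (waveBase q s ^ 2), ← h]
        simp
      rw [norm_pow, norm_waveBase, Real.sq_sqrt (by positivity)] at h1
      have h2 : q = 1 := by exact_mod_cast h1
      omega
    have hz : Continuous fun s : Spectrum q => waveBase q s :=
      continuous_waveBase.comp continuous_subtype_val
    have hDc : Continuous fun s : Spectrum q => D s :=
      (hz.pow _).mul (continuous_const.sub ((hz.pow 2).inv₀ fun s =>
        pow_ne_zero _ (waveBase_ne_zero hq s)))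
    let g₁ : C(Spectrum q, ℂ) := ⟨fun s => g s * (D s)⁻¹, g.continuous.mul (hDc.inv₀ fun s => hD s)⟩
    let g₂ : C(Spectrum q, ℂ) := ⟨fun s => g s * (D s)⁻¹ * (waveBase q s)⁻¹,
      (g.continuous.mul (hDc.inv₀ fun s => hD s)).mul (hz.inv₀ fun s => waveBase_ne_zero hq s)⟩
    have h1 : ∀ p : Boundary G o × Spectrum q,
        (cylinder G o x ×ˢ (Set.univ : Set (Spectrum q))).indicator (fun p => g p.2 * h p) p =
        g₁ p.2 * (h p * wavePlus q x p) - g₂ p.2 * (h p * wavePlus q u p) := by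
      intro p
      have h2 := zpow_height_child hG hu hd p.1 (waveBase_ne_zero hq p.2)
      rw [wavePlus_eq hq, wavePlus_eq hq, h2]
      simp only [Set.indicator, Set.mem_prod, Set.mem_univ, and_true, g₁, g₂,
        ContinuousMap.coe_mk]
      split_ifs with h3
      · have h4 : waveBase q p.2 ^ (G.dist o x : ℤ) * (1 - (waveBase q p.2 ^ 2)⁻¹) = D p.2 := by
          simp [D]
        rw [h4]
        have h5 := hD p.2
        linear_combination (-(g p.2 * h p)) * (inv_mul_cancel₀ h5)
      · ring
    rw [← integral_indicator ((measurableSet_cylinder x).prod MeasurableSet.univ)]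
    simp_rw [h1]
    rw [integral_sub (integrable_continuous_mul (integrable_mul_wavePlus hq hG hh.1 x) g₁)
      (integrable_continuous_mul (integrable_mul_wavePlus hq hG hh.1 u) g₂),
      hh.integral_continuous_mul hq hG hreg, hh.integral_continuous_mul hq hG hreg, sub_zero]

/-- The waves span a weak-* dense subspace of `L^∞(ν × μ)`. -/
theorem AnnihilatesWaves.ae_eq_zero (hq : 2 ≤ q) (hG : G.IsTree)
    (hreg : ∀ v, (G.neighborSet v).ncard = q + 1) {h : Boundary G o × Spectrum q → ℂ}
    (hh : AnnihilatesWaves h) : h =ᵐ[spectralMeasure G o q] 0 := by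
  -- the indicator function of a closed set is a limit of continuous functions
  have hclosed : ∀ (x : V) (C : Set (Spectrum q)), IsClosed C →
      ∫ p in cylinder G o x ×ˢ C, h p ∂spectralMeasure G o q = 0 := by
    intro x C hC
    have hpos : ∀ n : ℕ, (0 : ℝ) < 1 / ((n : ℝ) + 1) := fun n => by positivity
    have hlim := thickenedIndicator_tendsto_indicator_closure hpos
      tendsto_one_div_add_atTop_nhds_zero_nat C
    rw [hC.closure_eq, tendsto_pi_nhds] at hlim
    let g : ℕ → C(Spectrum q, ℂ) := fun n =>
      ⟨fun s => ((thickenedIndicator (hpos n) C s : ℝ) : ℂ), by fun_prop⟩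
    have h1 : Tendsto (fun n => ∫ p in cylinder G o x ×ˢ Set.univ, g n p.2 * h p
        ∂spectralMeasure G o q) atTop (𝓝 (∫ p in cylinder G o x ×ˢ Set.univ,
          (Prod.snd ⁻¹' C).indicator h p ∂spectralMeasure G o q)) := by
      refine tendsto_integral_of_dominated_convergence (fun p => ‖h p‖)
        (fun n => (integrable_continuous_mul hh.1 (g n)).1.restrict) hh.1.norm.restrict
        (fun n => Eventually.of_forall fun p => ?_) (Eventually.of_forall fun p => ?_)
      · rw [norm_mul]
        refine mul_le_of_le_one_left (norm_nonneg _) ?_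
        have := thickenedIndicator_le_one (hpos n) C p.2
        simpa [g] using this
      · have h2 := hlim p.2
        have h3 : Tendsto (fun n => g n p.2) atTop
            (𝓝 (((C.indicator (fun _ => 1) p.2 : NNReal) : ℝ) : ℂ)) :=
          ((Complex.continuous_ofReal.comp NNReal.continuous_coe).tendsto _).comp h2
        have h4 : (Prod.snd ⁻¹' C).indicator h p =
            (((C.indicator (fun _ => 1) p.2 : NNReal) : ℝ) : ℂ) * h p := by
          by_cases hp : p.2 ∈ C
          · simp [hp]
          · simp [hp]
        rw [h4]
        exact h3.mul_const _
    have h2 : ∀ n, ∫ p in cylinder G o x ×ˢ Set.univ, g n p.2 * h p ∂spectralMeasure G o q = 0 :=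
      fun n => hh.setIntegral_cylinder hq hG hreg (g n) x
    simp_rw [h2] at h1
    have h3 := tendsto_nhds_unique h1 tendsto_const_nhds
    rw [setIntegral_indicator (measurable_snd hC.measurableSet)] at h3
    rw [← h3]
    congr 2
    ext p
    simp
  have huniv : ∫ p, h p ∂spectralMeasure G o q = 0 := by
    have := hclosed o Set.univ isClosed_univ
    rwa [cylinder_root, Set.univ_prod_univ, Measure.restrict_univ] at this
  refine hh.1.ae_eq_zero_of_forall_setIntegral_eq_zero fun s hs hs' => ?_
  clear hs'
  have hgen : (Prod.instMeasurableSpace : MeasurableSpace (Boundary G o × Spectrum q)) =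
      MeasurableSpace.generateFrom (Set.image2 (· ×ˢ ·) (Set.range (cylinder G o))
        {C : Set (Spectrum q) | IsClosed C}) := by
    refine (generateFrom_eq_prod rfl ?_ ?_ ?_).symm
    · rw [← borel_eq_generateFrom_isClosed]
      exact BorelSpace.measurable_eq.symm
    · exact ⟨fun _ => Set.univ, fun _ => ⟨o, cylinder_root⟩, Set.iUnion_const _⟩
    · exact ⟨fun _ => Set.univ, fun _ => isClosed_univ, Set.iUnion_const _⟩
  induction s, hs using MeasurableSpace.induction_on_inter hgen
    ((isPiSystem_cylinder hG).prod isPiSystem_isClosed) with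
  | empty => simp
  | basic t ht =>
    obtain ⟨_, ⟨x, rfl⟩, C, hC, rfl⟩ := ht
    exact hclosed x C hC
  | compl t ht ih => rw [setIntegral_compl ht hh.1, huniv, ih, sub_zero]
  | iUnion f hd hf ih =>
    have := hasSum_integral_iUnion hf hd hh.1.integrableOn
    simp_rw [ih] at this
    exact this.unique hasSum_zero

end Injectivity

/-! ### Sequence spaces -/

section SequenceSpace

variable {ι : Type*}

/-- The pairing with an element of `ℓ^{p'}` is a functional on `ℓ^p`. -/
theorem exists_dual_of_lp {p p' : ℝ≥0∞} [Fact (1 ≤ p)] [Fact (1 ≤ p')]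
    (hconj : ENNReal.HolderConjugate p p') (g : lp (fun _ : ι => ℂ) p') :
    ∃ Λ : StrongDual ℂ (lp (fun _ : ι => ℂ) p),
      (∀ u, Λ u = ∑' y, u y * g y) ∧ ‖Λ‖ ≤ ‖g‖ := by
  have hB : ∀ i : ι, ‖(ContinuousLinearMap.mul ℂ ℂ)‖ ≤ ((1 : NNReal) : ℝ) := fun _ =>
    ContinuousLinearMap.opNorm_mul_le ℂ ℂ
  refine ⟨(lp.dualPairing (E := fun _ : ι => ℂ) (F := fun _ : ι => ℂ) p p'
    (fun _ => ContinuousLinearMap.mul ℂ ℂ) hB).flip g, fun u => ?_, ?_⟩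
  · rw [ContinuousLinearMap.flip_apply, lp.dualPairing_apply]
    rfl
  · refine (ContinuousLinearMap.le_opNorm _ _).trans ?_
    rw [ContinuousLinearMap.opNorm_flip]
    exact mul_le_of_le_one_left (norm_nonneg _) (lp.norm_dualPairing _ hB)

open Classical in
/-- A functional on `ℓ^p`, `1 ≤ p < ∞`, is given by an element of `ℓ^{p'}`. -/
theorem exists_lp_of_dual {p p' : ℝ≥0∞} [Fact (1 ≤ p)] (hp : p ≠ ⊤)
    (hconj : ENNReal.HolderConjugate p p') (Λ : StrongDual ℂ (lp (fun _ : ι => ℂ) p)) :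
    ∃ g : lp (fun _ : ι => ℂ) p', (∀ y, g y = Λ (lp.single p y 1)) ∧ ‖g‖ ≤ ‖Λ‖ := by
  have hp0 : 0 < p := zero_lt_one.trans_le Fact.out
  set γ : ι → ℂ := fun y => Λ (lp.single p y 1) with hγ
  by_cases hp' : p' = ⊤
  · subst hp'
    have hle : ∀ y, ‖γ y‖ ≤ ‖Λ‖ := fun y => by
      refine (Λ.le_opNorm _).trans ?_
      rw [lp.norm_single hp0, norm_one, mul_one]
    exact ⟨⟨γ, memℓp_infty ⟨‖Λ‖, by rintro _ ⟨y, rfl⟩; exact hle y⟩⟩, fun _ => rfl,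
      lp.norm_le_of_forall_le (norm_nonneg _) hle⟩
  have hr := ENNReal.HolderConjugate.toReal_of_ne_top (p := p) (q := p') hp hp'
  set a := p.toReal with ha
  set b := p'.toReal with hb
  have hb0 : 0 < b := hr.symm.pos
  have ha0 : 0 < a := hr.pos
  have key : ∀ S : Finset ι, ∑ y ∈ S, ‖γ y‖ ^ b ≤ ‖Λ‖ ^ b := by
    intro S
    set A := ∑ y ∈ S, ‖γ y‖ ^ b with hA
    have hA0 : 0 ≤ A := Finset.sum_nonneg fun y _ => by positivity
    rcases hA0.eq_or_lt with h0 | hApos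
    · rw [← h0]
      positivity
    -- the extremal vector of Hölder's inequality
    let c : ι → ℂ := fun y => conj (γ y) * ((‖γ y‖ ^ (b - 2) : ℝ) : ℂ)
    have hc1 : ∀ y, c y * γ y = ((‖γ y‖ ^ b : ℝ) : ℂ) := by
      intro y
      rcases eq_or_ne (γ y) 0 with h | h
      · simp [c, h, Real.zero_rpow hb0.ne']
      · have hn : 0 < ‖γ y‖ := norm_pos_iff.2 h
        have h1 : c y * γ y = (γ y * conj (γ y)) * ((‖γ y‖ ^ (b - 2) : ℝ) : ℂ) := by
          simp only [c]
          ring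
        rw [h1, Complex.mul_conj, Complex.normSq_eq_norm_sq, ← Complex.ofReal_mul,
          ← Real.rpow_natCast, ← Real.rpow_add hn]
        norm_num
    have hc2 : ∀ y, ‖c y‖ ^ a = ‖γ y‖ ^ b := by
      intro y
      rcases eq_or_ne (γ y) 0 with h | h
      · simp [c, h, Real.zero_rpow hb0.ne', Real.zero_rpow ha0.ne']
      · have hn : 0 < ‖γ y‖ := norm_pos_iff.2 h
        have h1 : ‖c y‖ = ‖γ y‖ ^ (b - 1) := by
          simp only [c, norm_mul, Complex.norm_conj, Complex.norm_real]
          rw [Real.norm_of_nonneg (by positivity)]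
          nth_rewrite 1 [← Real.rpow_one ‖γ y‖]
          rw [← Real.rpow_add hn]
          ring_nf
        rw [h1, ← Real.rpow_mul hn.le, hr.symm.sub_one_mul_conj]
    let u : lp (fun _ : ι => ℂ) p := ∑ y ∈ S, lp.single p y (c y)
    have hu1 : Λ u = (A : ℂ) := by
      simp only [u, map_sum]
      rw [hA, Complex.ofReal_sum]
      refine Finset.sum_congr rfl fun y _ => ?_
      rw [← hc1 y, hγ, ← smul_eq_mul, ← map_smul, ← lp.single_smul]
      simp
    have hu2 : ‖u‖ ^ a = A := by
      rw [ha, lp.norm_sum_single ha0]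
      exact Finset.sum_congr rfl fun y _ => hc2 y
    have hu3 : ‖u‖ = A ^ a⁻¹ := by
      rw [← hu2, Real.rpow_rpow_inv (norm_nonneg _) ha0.ne']
    have h1 : A ≤ ‖Λ‖ * A ^ a⁻¹ := by
      have h := Λ.le_opNorm u
      rw [hu1, Complex.norm_real, Real.norm_of_nonneg hA0, hu3] at h
      exact h
    have h2 : A ^ b⁻¹ ≤ ‖Λ‖ := by
      have h3 : A ^ b⁻¹ * A ^ a⁻¹ = A := by
        rw [← Real.rpow_add hApos, add_comm, hr.inv_add_inv_eq_one, Real.rpow_one]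
      exact le_of_mul_le_mul_right (h3.le.trans h1) (by positivity)
    calc A = (A ^ b⁻¹) ^ b := (Real.rpow_inv_rpow hA0 hb0.ne').symm
      _ ≤ ‖Λ‖ ^ b := by gcongr
  refine ⟨⟨γ, memℓp_gen' key⟩, fun _ => rfl, ?_⟩
  exact lp.norm_le_of_forall_sum_le hb0 (norm_nonneg _) key

open Classical in
/-- The restriction of an element of `ℓ^p` to a set, extended by zero. -/
noncomputable def lpRestrict {p : ℝ≥0∞} (S : Set ι) (f : lp (fun _ : ι => ℂ) p) :
    lp (fun _ : ι => ℂ) p :=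
  ⟨S.indicator f, (lp.memℓp f).mono' fun _ => norm_indicator_le_norm_self _ _⟩

theorem lpRestrict_apply {p : ℝ≥0∞} (S : Set ι) (f : lp (fun _ : ι => ℂ) p) (i : ι) :
    lpRestrict S f i = S.indicator f i := rfl

theorem norm_lpRestrict_le_of_subset {p : ℝ≥0∞} (hp : p ≠ 0) {S T : Set ι} (h : S ⊆ T)
    (f : lp (fun _ : ι => ℂ) p) : ‖lpRestrict S f‖ ≤ ‖lpRestrict T f‖ :=
  lp.norm_mono hp fun _ => norm_indicator_le_of_subset h _ _

theorem norm_lpRestrict_le {p : ℝ≥0∞} (hp : p ≠ 0) (S : Set ι)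
    (f : lp (fun _ : ι => ℂ) p) : ‖lpRestrict S f‖ ≤ ‖f‖ :=
  lp.norm_mono hp fun _ => norm_indicator_le_norm_self _ _

theorem tendsto_lpRestrict {p : ℝ≥0∞} [Fact (1 ≤ p)] (hp : p ≠ ⊤) (f : lp (fun _ : ι => ℂ) p) :
    Tendsto (fun S : Finset ι => lpRestrict (S : Set ι) f) atTop (𝓝 f) := by
  classical
  refine Tendsto.congr (fun S => ?_) (lp.hasSum_single hp f)
  ext i
  rw [lp.coeFn_sum, lpRestrict_apply]
  refine (Finset.sum_apply i S _).trans ?_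
  simp [Set.indicator_apply, Finset.sum_pi_single]

theorem tendsto_norm_lpRestrict_compl {p : ℝ≥0∞} [Fact (1 ≤ p)] (hp : p ≠ ⊤)
    (f : lp (fun _ : ι => ℂ) p) :
    Tendsto (fun S : Finset ι => ‖lpRestrict (S : Set ι)ᶜ f‖) atTop (𝓝 0) := by
  have h := (tendsto_const_nhds (x := f)).sub (tendsto_lpRestrict hp f)
  rw [sub_self] at h
  refine Tendsto.congr (fun S => ?_) h.norm |>.trans (by simp)
  congr 1
  ext i
  simp [lpRestrict_apply, Set.indicator_compl]

/-- The inclusion of `ℓ^r` into `ℓ²`, `1 ≤ r ≤ 2`, is a contraction. -/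
theorem exists_lp_two {r : ℝ≥0∞} [hr1 : Fact (1 ≤ r)] (hr : r ≤ 2) (g : lp (fun _ : ι => ℂ) r) :
    ∃ g₂ : lp (fun _ : ι => ℂ) 2, (⇑g₂ : ι → ℂ) = g ∧ ‖g₂‖ ≤ ‖g‖ := by
  refine ⟨⟨g, (lp.memℓp g).of_exponent_ge hr⟩, rfl, ?_⟩
  have hrt : r ≠ ⊤ := ne_top_of_le_ne_top (by simp) hr
  have hr0 : r ≠ 0 := (zero_lt_one.trans_le hr1.out).ne'
  have hr0' : 0 < r.toReal := ENNReal.toReal_pos hr0 hrt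
  have hr2 : r.toReal ≤ 2 := by simpa using ENNReal.toReal_mono ENNReal.ofNat_ne_top hr
  refine lp.norm_le_of_forall_sum_le (E := fun _ : ι => ℂ) (p := 2) (C := ‖g‖) (by norm_num)
    (norm_nonneg g) fun S => ?_
  have hN : 0 ≤ ‖g‖ := norm_nonneg _
  rcases hN.eq_or_lt with h0 | hpos
  · have hg : g = 0 := norm_eq_zero.1 h0.symm
    have h1 : ∀ y, (g : ι → ℂ) y = 0 := fun y => by
      rw [hg]
      rfl
    simp [h1, h0.symm]
  have h1 : ∀ y, ‖g y‖ ^ (2 : ℝ) ≤ ‖g y‖ ^ r.toReal * ‖g‖ ^ (2 - r.toReal) := by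
    intro y
    have hy := lp.norm_apply_le_norm hr0 g y
    calc ‖g y‖ ^ (2 : ℝ) = ‖g y‖ ^ r.toReal * ‖g y‖ ^ (2 - r.toReal) := by
          rw [← Real.rpow_add' (norm_nonneg _) (by norm_num)]
          norm_num
      _ ≤ _ := by
          gcongr
  calc ∑ y ∈ S, ‖g y‖ ^ (2 : ℝ≥0∞).toReal ≤ ∑ y ∈ S, ‖g y‖ ^ r.toReal * ‖g‖ ^ (2 - r.toReal) :=
        Finset.sum_le_sum fun y _ => by simpa using h1 y
    _ = (∑ y ∈ S, ‖g y‖ ^ r.toReal) * ‖g‖ ^ (2 - r.toReal) := by rw [Finset.sum_mul]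
    _ ≤ ‖g‖ ^ r.toReal * ‖g‖ ^ (2 - r.toReal) := by
        gcongr
        exact lp.sum_rpow_le_norm_rpow hr0' g S
    _ = ‖g‖ ^ (2 : ℝ≥0∞).toReal := by
        rw [← Real.rpow_add hpos]
        norm_num

end SequenceSpace

/-! ### Series of integrable functions -/

section Series

variable {X : Type*} [MeasurableSpace X] {μ : Measure X}

theorem integrable_tsum_of_summable_integral_norm {F : ℕ → X → ℂ}
    (hF : ∀ k, Integrable (F k) μ) (hsum : Summable fun k => ∫ a, ‖F k a‖ ∂μ) :
    (∀ᵐ a ∂μ, Summable fun k => F k a) ∧ Integrable (fun a => ∑' k, F k a) μ := by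
  have h1 : ∀ k, MemLp (F k) 1 μ := fun k => memLp_one_iff_integrable.2 (hF k)
  have h2 : ∀ k, ‖(h1 k).toLp‖ = ∫ a, ‖F k a‖ ∂μ := fun k => by
    rw [Lp.norm_toLp, integral_norm_eq_lintegral_enorm (hF k).1, eLpNorm_one_eq_lintegral_enorm]
  have h3 : ∑' k, ‖(h1 k).toLp‖ₑ ≠ ∞ := by
    rw [tsum_enorm_ne_top_iff_summable_norm]
    simpa only [h2] using hsum
  have h4 : ∀ᵐ a ∂μ, HasSum (fun k => F k a) ((∑' k, (h1 k).toLp : Lp ℂ 1 μ) a) := by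
    filter_upwards [Lp.hasSum_coeFn_tsum h3, ae_all_iff.2 fun k => (h1 k).coeFn_toLp] with a ha hb
    simpa only [hb] using ha
  refine ⟨h4.mono fun a ha => ha.summable, ?_⟩
  refine (memLp_one_iff_integrable.1 (Lp.memLp (∑' k, (h1 k).toLp : Lp ℂ 1 μ))).congr ?_
  exact h4.mono fun a ha => ha.tsum_eq.symm

end Series

/-! ### Nuclear operators and weak decompositions -/

section Weak

variable {V : Type*} {G : SimpleGraph V} {o : V} {q : ℕ}
  {σ : V → Boundary G o → Spectrum q → ℂ}

theorem hasSum_lp_apply {ι : Type*} {p : ℝ≥0∞} [Fact (1 ≤ p)]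
    {a : ℕ → lp (fun _ : ι => ℂ) p} {u : lp (fun _ : ι => ℂ) p} (h : HasSum a u) (x : ι) :
    HasSum (fun k => a k x) (u x) :=
  h.mapL (lp.evalCLM ℂ (fun _ : ι => ℂ) p x)

theorem helgason_single [DecidableEq V] (y : V) (p : Boundary G o × Spectrum q) :
    helgason q (Pi.single y 1) p = wavePlus q y p := by
  rw [helgason_eq_sum (S := {y}) (by simp)]
  simp

theorem helgasonPairing_single [DecidableEq V] (y : V) (g : V → ℂ) :
    helgasonPairing (Pi.single y 1) g = conj (g y) := by
  rw [helgasonPairing_eq_sum (S := {y}) (by simp)]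
  simp

theorem finite_support_single [DecidableEq V] (y : V) :
    (Function.support (Pi.single y (1 : ℂ) : V → ℂ)).Finite :=
  (Set.finite_singleton y).subset Pi.support_single_subset

theorem wavePlus_root (hq : 2 ≤ q) (p : Boundary G o × Spectrum q) : wavePlus q o p = 1 := by
  rw [wavePlus_eq hq, height_root, zpow_zero]

/-- The wave at the root is constant, so the absolute convergence for `δ_o` says that the symbol
times the wave is integrable. -/
theorem PseudoDiffDefined.integrable (hq : 2 ≤ q) (h : PseudoDiffDefined q σ) (x : V) :
    Integrable (fun p => waveMinus q x p * σ x p.1 p.2) (spectralMeasure G o q) := by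
  classical
  have h1 := h _ (finite_support_single o) x
  simpa only [helgason_single, wavePlus_root hq, mul_one] using h1

theorem exists_norm_helgason_le (hq : 2 ≤ q) {φ : V → ℂ} (hφ : φ.support.Finite) :
    ∃ C, ∀ p : Boundary G o × Spectrum q, ‖helgason q φ p‖ ≤ C := by
  refine ⟨∑ y ∈ hφ.toFinset, ‖φ y‖ * √q ^ G.dist o y, fun p => ?_⟩
  rw [helgason_eq_sum (S := hφ.toFinset) (by simp)]
  refine (norm_sum_le _ _).trans (Finset.sum_le_sum fun y _ => ?_)
  rw [norm_mul]
  gcongr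
  exact norm_wavePlus_le hq y p

/-- A series of transforms that converges absolutely in `L¹` represents the series of the
functionals given by the Plancherel formula. -/
theorem series_of_isL1Transform (hq : 2 ≤ q) (hG : G.IsTree) {a : ℕ → ℂ} {g : ℕ → V → ℂ}
    {F : ℕ → Boundary G o × Spectrum q → ℂ} (hF : ∀ k, IsL1Transform q (g k) (F k))
    (hsum : Summable fun k => ‖a k‖ * ∫ p, ‖F k p‖ ∂spectralMeasure G o q) :
    (∀ᵐ p ∂spectralMeasure G o q, Summable fun k => a k * conj (F k p)) ∧
    Integrable (fun p => ∑' k, a k * conj (F k p)) (spectralMeasure G o q) ∧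
    ∀ φ : V → ℂ, φ.support.Finite → HasSum (fun k => a k * helgasonPairing φ (g k))
      (∫ p, (∑' k, a k * conj (F k p)) * helgason q φ p ∂spectralMeasure G o q) := by
  have hconj : ∀ k, Integrable (fun p => conj (F k p)) (spectralMeasure G o q) := fun k =>
    (Complex.conjLIE.integrable_comp_iff).2 (hF k).1
  have hint : ∀ k, Integrable (fun p => a k * conj (F k p)) (spectralMeasure G o q) := fun k =>
    (hconj k).const_mul (a k)
  have hnorm : ∀ k, ∫ p, ‖a k * conj (F k p)‖ ∂spectralMeasure G o q =
      ‖a k‖ * ∫ p, ‖F k p‖ ∂spectralMeasure G o q := fun k => by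
    simp_rw [norm_mul, Complex.norm_conj]
    rw [integral_const_mul]
  have h1 := integrable_tsum_of_summable_integral_norm hint (by simpa only [hnorm] using hsum)
  refine ⟨h1.1, h1.2, fun φ hφ => ?_⟩
  obtain ⟨C, hC⟩ := exists_norm_helgason_le (G := G) (o := o) hq hφ
  have hint2 : ∀ k, Integrable (fun p => a k * conj (F k p) * helgason q φ p)
      (spectralMeasure G o q) := fun k => integrable_mul_helgason hq hG (hint k) hφ
  have hsum2 : Summable fun k => ∫ p, ‖a k * conj (F k p) * helgason q φ p‖
      ∂spectralMeasure G o q := by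
    refine Summable.of_nonneg_of_le (fun k => integral_nonneg fun p => norm_nonneg _) (fun k => ?_)
      (hsum.mul_right C)
    rw [← hnorm, ← integral_mul_const]
    refine integral_mono (hint2 k).norm ((hint k).norm.mul_const C) fun p => ?_
    simp only [norm_mul (a k * conj (F k p))]
    gcongr
    exact hC p
  have h2 := hasSum_integral_of_summable_integral_norm hint2 hsum2
  simp_rw [tsum_mul_right] at h2
  have h3 : ∀ k, ∫ p, a k * conj (F k p) * helgason q φ p ∂spectralMeasure G o q =
      a k * helgasonPairing φ (g k) := fun k => by
    rw [← (hF k).integral_conj_mul_helgason hq hG hφ, ← integral_const_mul]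
    simp_rw [mul_assoc]
  simpa only [h3] using h2

theorem HasL1Decomposition.hasWeakDecomposition (hq : 2 ≤ q) (hG : G.IsTree) {r p₂ : ℝ≥0∞}
    (h : HasL1Decomposition q σ r p₂) : HasWeakDecomposition q σ r p₂ := by
  obtain ⟨g, f, F, hs, hF, hsum, hσ⟩ := h
  have hS : ∀ x, (fun p => waveMinus q x p * σ x p.1 p.2) =ᵐ[spectralMeasure G o q]
      fun p => ∑' k, f k x * conj (F k p) := by
    intro x
    filter_upwards [hσ x] with p hp
    rw [hp.2, mul_inv_cancel_left₀ (waveMinus_ne_zero hq x p)]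
  have hser := fun x => series_of_isL1Transform hq hG hF (hsum x)
  refine ⟨fun φ hφ x => ?_, g, f, hs, fun x φ hφ => ?_⟩
  · exact integrable_mul_helgason hq hG ((hser x).2.1.congr (hS x).symm) hφ
  · have h1 := (hser x).2.2 φ hφ
    convert h1 using 1
    refine integral_congr_ae ?_
    filter_upwards [hS x] with p hp
    rw [hp]

theorem HasL2Decomposition.hasL1Decomposition (hq : 2 ≤ q) (hG : G.IsTree)
    (hreg : ∀ v, (G.neighborSet v).ncard = q + 1) {r p₂ : ℝ≥0∞} [Fact (1 ≤ r)] [Fact (1 ≤ p₂)]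
    (hr : r ≤ 2) (h : HasL2Decomposition q σ r p₂) : HasL1Decomposition q σ r p₂ := by
  obtain ⟨g, f, F, hs, hF, hσ⟩ := h
  have hg : ∀ k, ∃ g₂ : lp (fun _ : V => ℂ) 2, (⇑g₂ : V → ℂ) = (fun y => conj (g k y)) ∧
      ‖g₂‖ ≤ ‖g k‖ := by
    intro k
    obtain ⟨g₂, h1, h2⟩ := exists_lp_two hr (star (g k))
    exact ⟨g₂, h1, h2.trans_eq (norm_star _)⟩
  choose g₂ hg₂ hg₂n using hg
  have hF' : ∀ k, IsL2Transform q (g₂ k) (F k) := fun k => by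
    rw [hg₂]
    exact hF k
  refine ⟨g, f, F, hs, fun k => ?_, fun x => ?_, hσ⟩
  · rw [← hg₂]
    exact (hF' k).isL1Transform hq hG hreg
  · refine Summable.of_nonneg_of_le
      (fun k => mul_nonneg (norm_nonneg _) (integral_nonneg fun p => norm_nonneg _)) (fun k => ?_) hs
    rw [mul_comm ‖g k‖]
    have hp₂ : p₂ ≠ 0 := (zero_lt_one.trans_le (Fact.out : 1 ≤ p₂)).ne'
    exact mul_le_mul (lp.norm_apply_le_norm hp₂ _ _)
      (((hF' k).integral_norm_le hq hG hreg).trans (hg₂n k))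
      (integral_nonneg fun p => norm_nonneg _) (norm_nonneg _)

theorem HasWeakDecomposition.isNuclearPseudoDiff {p₁ p₂ p₁' : ℝ≥0∞}
    [Fact (1 ≤ p₁)] [Fact (1 ≤ p₂)] [Fact (1 ≤ p₁')] (hconj : ENNReal.HolderConjugate p₁ p₁')
    (h : HasWeakDecomposition q σ p₁' p₂) : IsNuclearPseudoDiff q σ p₁ p₂ := by
  obtain ⟨hdef, g, f, hs, hsum⟩ := h
  choose Λ hΛ hΛn using fun k => exists_dual_of_lp hconj (g k)
  have hs' : Summable fun k => ‖Λ k‖ * ‖f k‖ := by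
    refine Summable.of_nonneg_of_le (fun k => by positivity) (fun k => ?_) hs
    gcongr
    exact hΛn k
  have hT : HasSum (fun k => (Λ k).smulRight (f k)) (∑' k, (Λ k).smulRight (f k)) := by
    refine Summable.hasSum (Summable.of_norm ?_)
    simpa only [ContinuousLinearMap.norm_smulRight_apply] using hs'
  have hT' : ∀ u, HasSum (fun k => Λ k u • f k) ((∑' k, (Λ k).smulRight (f k)) u) := fun u =>
    hT.mapL (ContinuousLinearMap.apply ℂ (LpTree V p₂) u)
  refine ⟨hdef, ∑' k, (Λ k).smulRight (f k), fun u hu x => ?_, Λ, f, hs', hT'⟩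
  have h1 := hasSum_lp_apply (hT' u) x
  refine h1.unique ?_
  have h2 := hsum x u hu
  convert h2 using 2 with k
  · rw [lp.coeFn_smul, Pi.smul_apply, smul_eq_mul, hΛ, mul_comm, helgasonPairing]
    simp
  · rfl

theorem IsNuclearPseudoDiff.hasWeakDecomposition {p₁ p₂ p₁' : ℝ≥0∞}
    [Fact (1 ≤ p₁)] [Fact (1 ≤ p₂)] (hp₁ : p₁ ≠ ⊤) (hconj : ENNReal.HolderConjugate p₁ p₁')
    (h : IsNuclearPseudoDiff q σ p₁ p₂) : HasWeakDecomposition q σ p₁' p₂ := by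
  classical
  obtain ⟨hdef, T, hT, Λ, f, hs, hsum⟩ := h
  choose g hg hgn using fun k => exists_lp_of_dual hp₁ hconj (Λ k)
  refine ⟨hdef, g, f, ?_, fun x φ hφ => ?_⟩
  · refine Summable.of_nonneg_of_le (fun k => mul_nonneg (lp.norm_nonneg' _) (norm_nonneg _))
      (fun k => ?_) hs
    exact mul_le_mul_of_nonneg_right (hgn k) (norm_nonneg _)
  · let u : LpTree V p₁ := ∑ y ∈ hφ.toFinset, lp.single p₁ y (φ y)
    have hu : (u : V → ℂ) = φ := by
      funext i
      refine (congrFun (lp.coeFn_sum _ _) i).trans ((Finset.sum_apply i hφ.toFinset _).trans ?_)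
      simp only [lp.single_apply, Finset.sum_pi_single, Set.Finite.mem_toFinset,
        Function.mem_support]
      split_ifs with h
      · rfl
      · exact (not_not.1 h).symm
    have h1 := hasSum_lp_apply (hsum u) x
    rw [hT u (by rw [hu]; exact hφ) x, hu] at h1
    convert h1 using 2 with k
    · rw [lp.coeFn_smul, Pi.smul_apply, smul_eq_mul, mul_comm,
        helgasonPairing_eq_sum (S := hφ.toFinset) (by simp), map_sum]
      congr 1
      refine Finset.sum_congr rfl fun y _ => ?_
      rw [Complex.conj_conj, hg, ← smul_eq_mul, ← map_smul, ← lp.single_smul]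
      simp
    · rfl

/-- For `r ≤ 2` the terms of the weak decomposition themselves have transforms, and the injectivity
of the inversion formula turns the weak equation into one that holds almost everywhere. -/
theorem HasWeakDecomposition.hasL2Decomposition (hq : 2 ≤ q) (hG : G.IsTree)
    (hreg : ∀ v, (G.neighborSet v).ncard = q + 1) {r p₂ : ℝ≥0∞} [Fact (1 ≤ r)] [Fact (1 ≤ p₂)]
    (hr : r ≤ 2) (h : HasWeakDecomposition q σ r p₂) : HasL2Decomposition q σ r p₂ := by
  classical
  obtain ⟨hdef, g, f, hs, hsum⟩ := h
  have hg : ∀ k, ∃ g₂ : lp (fun _ : V => ℂ) 2, (⇑g₂ : V → ℂ) = (fun y => conj (g k y)) ∧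
      ‖g₂‖ ≤ ‖g k‖ := by
    intro k
    obtain ⟨g₂, h1, h2⟩ := exists_lp_two hr (star (g k))
    exact ⟨g₂, h1, h2.trans_eq (norm_star _)⟩
  choose g₂ hg₂ hg₂n using hg
  let F : ℕ → Boundary G o × Spectrum q → ℂ := fun k => plancherelIsometry hq hG hreg (g₂ k)
  have hF : ∀ k, IsL2Transform q (g₂ k) (F k) := fun k =>
    isL2Transform_plancherelIsometry hq hG hreg _
  have hF1 : ∀ k, IsL1Transform q (fun y => conj (g k y)) (F k) := fun k => by
    rw [← hg₂]
    exact (hF k).isL1Transform hq hG hreg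
  have hsum' : ∀ x, Summable fun k => ‖f k x‖ * ∫ p, ‖F k p‖ ∂spectralMeasure G o q := fun x => by
    refine Summable.of_nonneg_of_le
      (fun k => mul_nonneg (norm_nonneg _) (integral_nonneg fun p => norm_nonneg _)) (fun k => ?_) hs
    rw [mul_comm ‖g k‖]
    have hp₂ : p₂ ≠ 0 := (zero_lt_one.trans_le (Fact.out : 1 ≤ p₂)).ne'
    exact mul_le_mul (lp.norm_apply_le_norm hp₂ _ _)
      (((hF k).integral_norm_le hq hG hreg).trans (hg₂n k))
      (integral_nonneg fun p => norm_nonneg _) (norm_nonneg _)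
  refine ⟨g, f, F, hs, fun k => ?_, fun x => ?_⟩
  · rw [← hg₂]
    exact hF k
  obtain ⟨hae, hint, hser⟩ := series_of_isL1Transform hq hG hF1 (hsum' x)
  have hS := hdef.integrable hq x
  -- the symbol and the series have the same integrals against all waves
  have hann : AnnihilatesWaves fun p => waveMinus q x p * σ x p.1 p.2 -
      ∑' k, f k x * conj (F k p) := by
    refine ⟨hS.sub hint, fun y => ?_⟩
    simp_rw [sub_mul]
    rw [integral_sub (integrable_mul_wavePlus hq hG hS y) (integrable_mul_wavePlus hq hG hint y),
      sub_eq_zero]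
    have h1 := hsum x _ (finite_support_single y)
    have h2 := hser _ (finite_support_single y)
    simpa only [helgason_single] using h1.unique h2
  filter_upwards [hae, hann.ae_eq_zero hq hG hreg] with p h1 h2
  refine ⟨h1, ?_⟩
  rw [← sub_eq_zero.1 h2, inv_mul_cancel_left₀ (waveMinus_ne_zero hq x p)]

end Weak

/-! ### Regrouping a nuclear series into one with integrable transforms -/

section Regrouping

/-- The index set splits into finite blocks such that cutting every `f k` along the blocks does not
destroy the convergence of the nuclear series. -/
theorem exists_summable_blocks {ι : Type*} [Countable ι] {p : ℝ≥0∞} [Fact (1 ≤ p)] (hp : p ≠ ⊤)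
    (f : ℕ → lp (fun _ : ι => ℂ) p) {w : ℕ → ℝ} (hw : ∀ k, 0 ≤ w k)
    (hs : Summable fun k => w k * ‖f k‖) :
    ∃ b : ι → ℕ, (∀ j, {x | b x = j}.Finite) ∧
      Summable fun jk : ℕ × ℕ => w jk.2 * ‖lpRestrict {x | b x = jk.1} (f jk.2)‖ := by
  classical
  have hp0 : p ≠ 0 := (zero_lt_one.trans_le (Fact.out : 1 ≤ p)).ne'
  have hle : ∀ (S : Set ι) k, w k * ‖lpRestrict S (f k)‖ ≤ w k * ‖f k‖ := fun S k =>
    mul_le_mul_of_nonneg_left (norm_lpRestrict_le hp0 S _) (hw k)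
  have hsum : ∀ S : Set ι, Summable fun k => w k * ‖lpRestrict S (f k)‖ := fun S =>
    Summable.of_nonneg_of_le (fun k => mul_nonneg (hw k) (norm_nonneg _)) (hle S) hs
  have htail : Tendsto (fun S : Finset ι => ∑' k, w k * ‖lpRestrict (S : Set ι)ᶜ (f k)‖) atTop
      (𝓝 0) := by
    have h := tendsto_tsum_of_dominated_convergence (𝓕 := (atTop : Filter (Finset ι)))
      (f := fun S k => w k * ‖lpRestrict (S : Set ι)ᶜ (f k)‖) (g := fun _ => 0) hs
      (fun k => by simpa using (tendsto_norm_lpRestrict_compl hp (f k)).const_mul (w k))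
      (Eventually.of_forall fun S k => by
        rw [Real.norm_of_nonneg (mul_nonneg (hw k) (norm_nonneg _))]
        exact hle _ k)
    simpa using h
  obtain ⟨A, hA⟩ := exists_seq_tendsto (atTop : Filter (Finset ι))
  obtain ⟨n, hn, hbound⟩ := extraction_forall_of_eventually
    (P := fun j m => ∑' k, w k * ‖lpRestrict (A m : Set ι)ᶜ (f k)‖ < (1 / 2 : ℝ) ^ j) fun j =>
      (htail.comp hA).eventually (gt_mem_nhds (by positivity))
  have hex : ∀ x, ∃ j, x ∈ A (n j) := fun x =>
    (((hA.comp hn.tendsto_atTop).eventually (eventually_ge_atTop {x})).exists).imp fun j hj =>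
      Finset.singleton_subset_iff.1 hj
  -- the block of a point is given by the first exhausting set that contains it
  obtain ⟨b, hb, hmin⟩ : ∃ b : ι → ℕ, (∀ x, x ∈ A (n (b x))) ∧ ∀ x j, x ∈ A (n j) → b x ≤ j :=
    ⟨fun x => Nat.find (hex x), fun x => Nat.find_spec (hex x), fun x _ h => Nat.find_min' (hex x) h⟩
  refine ⟨b, fun j => ?_, ?_⟩
  · refine (A (n j)).finite_toSet.subset ?_
    rintro x rfl
    exact hb x
  · refine (summable_prod_of_nonneg fun jk => mul_nonneg (hw _) (norm_nonneg _)).2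
      ⟨fun j => hsum {x | b x = j}, ?_⟩
    refine (summable_nat_add_iff 1).1 ?_
    refine Summable.of_nonneg_of_le
      (fun j => tsum_nonneg fun k => mul_nonneg (hw _) (norm_nonneg _)) (fun j => ?_)
      (summable_geometric_of_lt_one (by norm_num) (by norm_num : (1 / 2 : ℝ) < 1))
    refine le_trans ((hsum {x | b x = j + 1}).tsum_le_tsum (fun k => ?_)
      (hsum (A (n j) : Set ι)ᶜ)) (hbound j).le
    refine mul_le_mul_of_nonneg_left (norm_lpRestrict_le_of_subset hp0 ?_ _) (hw k)
    intro x hx hxj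
    have h1 : b x = j + 1 := hx
    have h2 := hmin x j (Finset.mem_coe.1 hxj)
    omega

/-- On finitely many rows a nuclear series is approximated by a finite sum whose terms are finitely
supported. -/
theorem exists_finite_approximation {ι κ : Type*} {r : ℝ≥0∞} [Fact (1 ≤ r)] (hr : r ≠ ⊤)
    (g : ℕ → lp (fun _ : κ => ℂ) r) (a : ι → ℕ → ℂ) (K : ι → lp (fun _ : κ => ℂ) r)
    (hK : ∀ x, HasSum (fun k => a x k • g k) (K x)) {ε : ι → ℝ} (hε : ∀ x, 0 < ε x)
    {B : Set ι} (hB : B.Finite) :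
    ∃ (N : ℕ) (T : Finset κ), ∀ x ∈ B,
      ‖K x - ∑ k ∈ Finset.range N, a x k • lpRestrict (T : Set κ) (g k)‖ ≤ ε x := by
  have h1 : ∀ᶠ N in atTop, ∀ x ∈ B, dist (∑ k ∈ Finset.range N, a x k • g k) (K x) < ε x / 2 :=
    (eventually_all_finite hB).2 fun x _ =>
      (Metric.tendsto_nhds.1 (hK x).tendsto_sum_nat) _ (half_pos (hε x))
  obtain ⟨N, hN⟩ := h1.exists
  have h2 : ∀ᶠ T : Finset κ in atTop, ∀ x ∈ B,
      dist (∑ k ∈ Finset.range N, a x k • lpRestrict (T : Set κ) (g k))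
        (∑ k ∈ Finset.range N, a x k • g k) < ε x / 2 :=
    (eventually_all_finite hB).2 fun x _ =>
      (Metric.tendsto_nhds.1 (tendsto_finsetSum _ fun k _ =>
        (tendsto_lpRestrict hr (g k)).const_smul (a x k))) _ (half_pos (hε x))
  obtain ⟨T, hT⟩ := h2.exists
  refine ⟨N, T, fun x hx => ?_⟩
  rw [← dist_eq_norm, dist_comm]
  linarith [dist_triangle (∑ k ∈ Finset.range N, a x k • lpRestrict (T : Set κ) (g k))
    (∑ k ∈ Finset.range N, a x k • g k) (K x), hN x hx, hT x hx]

variable {V : Type*} {G : SimpleGraph V} {o : V} {q : ℕ}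

theorem IsL1Transform.sub {g₁ g₂ : V → ℂ} (hq : 2 ≤ q) (hG : G.IsTree)
    {F₁ F₂ : Boundary G o × Spectrum q → ℂ}
    (h₁ : IsL1Transform q g₁ F₁) (h₂ : IsL1Transform q g₂ F₂) :
    IsL1Transform q (fun y => g₁ y - g₂ y) fun p => F₁ p - F₂ p := by
  refine ⟨h₁.1.sub h₂.1, fun y => ?_⟩
  have hint : ∀ {F : Boundary G o × Spectrum q → ℂ}, Integrable F (spectralMeasure G o q) →
      Integrable (fun p => waveMinus q y p * F p) (spectralMeasure G o q) := fun hF =>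
    hF.bdd_mul (measurable_waveMinus hq hG y).aestronglyMeasurable
      (Eventually.of_forall (norm_waveMinus_le hq y))
  simp_rw [mul_sub]
  rw [integral_sub (hint h₁.1) (hint h₂.1), h₁.2, h₂.2]

theorem IsL1Transform.const_mul {g : V → ℂ} {F : Boundary G o × Spectrum q → ℂ}
    (h : IsL1Transform q g F) (c : ℂ) :
    IsL1Transform q (fun y => c * g y) fun p => c * F p := by
  refine ⟨h.1.const_mul c, fun y => ?_⟩
  simp_rw [mul_left_comm _ c]
  rw [integral_const_mul, h.2]

theorem IsL1Transform.finsetSum {ι : Type*} (S : Finset ι) (hq : 2 ≤ q) (hG : G.IsTree)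
    {g : ι → V → ℂ} {F : ι → Boundary G o × Spectrum q → ℂ}
    (h : ∀ i ∈ S, IsL1Transform q (g i) (F i)) :
    IsL1Transform q (fun y => ∑ i ∈ S, g i y) fun p => ∑ i ∈ S, F i p := by
  refine ⟨integrable_finsetSum _ fun i hi => (h i hi).1, fun y => ?_⟩
  simp_rw [Finset.mul_sum]
  rw [integral_finsetSum _ fun i hi => (h i hi).1.bdd_mul
    (measurable_waveMinus hq hG y).aestronglyMeasurable
      (Eventually.of_forall (norm_waveMinus_le hq y))]
  exact Finset.sum_congr rfl fun i hi => (h i hi).2 y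

variable {σ : V → Boundary G o → Spectrum q → ℂ}

set_option maxHeartbeats 1000000 in
/-- For `r < ∞` the terms of a weak decomposition can be regrouped so that all transforms become
integrable. The vertices are divided into finite blocks. In each block finitely many terms, cut to
the block and made finitely supported, are kept, and for each vertex `x` of the block one more term
`δ_x ⊗ R_x` collects the remainder. The transform of `R_x` is obtained from the one of the row of
the kernel, which is the symbol itself. For a fixed `x` only finitely many of the new terms are
different from zero, and they add up to the symbol exactly. -/
theorem HasWeakDecomposition.hasL1Decomposition (hq : 2 ≤ q) (hG : G.IsTree)
    (hreg : ∀ v, (G.neighborSet v).ncard = q + 1) {r p₂ : ℝ≥0∞} [Fact (1 ≤ r)] [Fact (1 ≤ p₂)]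
    (hr : r ≠ ⊤) (hp₂ : p₂ ≠ ⊤) (h : HasWeakDecomposition q σ r p₂) :
    HasL1Decomposition q σ r p₂ := by
  classical
  have hcount := countable_of_locallyFinite hG hreg
  obtain ⟨_⟩ := nonempty_encodable V
  obtain ⟨hdef, g, f, hs, hsum⟩ := h
  have hp₂0 : p₂ ≠ 0 := (zero_lt_one.trans_le (Fact.out : 1 ≤ p₂)).ne'
  have hr0 : r ≠ 0 := (zero_lt_one.trans_le (Fact.out : 1 ≤ r)).ne'
  set S : V → Boundary G o × Spectrum q → ℂ := fun x p => waveMinus q x p * σ x p.1 p.2 with hSdef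
  have hS : ∀ x, Integrable (S x) (spectralMeasure G o q) := fun x => hdef.integrable hq x
  -- the rows of the kernel
  have hKsum : ∀ x, Summable fun k => f k x • g k := fun x => by
    refine Summable.of_norm (Summable.of_nonneg_of_le (fun k => norm_nonneg _) (fun k => ?_) hs)
    rw [norm_smul, mul_comm]
    exact mul_le_mul_of_nonneg_left (lp.norm_apply_le_norm hp₂0 _ _) (norm_nonneg _)
  set K : V → LpTree V r := fun x => ∑' k, f k x • g k
  have hK : ∀ x, HasSum (fun k => f k x • g k) (K x) := fun x => (hKsum x).hasSum
  have hKtransform : ∀ x, IsL1Transform q (fun y => conj (K x y)) fun p => conj (S x p) := by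
    refine fun x => ⟨(Complex.conjLIE.integrable_comp_iff).2 (hS x), fun y => ?_⟩
    have h1 := hsum x _ (finite_support_single y)
    have h2 := hasSum_lp_apply (hK x) y
    simp only [helgasonPairing_single, Complex.conj_conj, helgason_single] at h1
    have h3 : K x y = ∫ p, S x p * wavePlus q y p ∂spectralMeasure G o q := h2.unique h1
    refine Eq.trans ?_ (congrArg conj h3).symm
    rw [← integral_conj]
    congr 1
    funext p
    rw [map_mul, conj_wavePlus hq, mul_comm]
  obtain ⟨b, hb, hbs⟩ := exists_summable_blocks hp₂ f (fun k => norm_nonneg (g k)) hs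
  obtain ⟨ε, hε, c, hεsum, -⟩ := posSumOfEncodable one_pos V
  choose N T hNT using fun j =>
    exists_finite_approximation hr g (fun x k => f k x) K hK hε (hb j)
  -- the new terms
  let g' : ℕ × ℕ → LpTree V r := fun jk => lpRestrict (T jk.1 : Set V) (g jk.2)
  let R : V → LpTree V r := fun x => K x - ∑ k ∈ Finset.range (N (b x)), f k x • g' (b x, k)
  let H : ℕ × ℕ → Boundary G o × Spectrum q → ℂ := fun jk =>
    helgason q fun y => conj (g' jk y)
  let gn : (ℕ × ℕ) ⊕ V → LpTree V r := Sum.elim g' R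
  let fn : (ℕ × ℕ) ⊕ V → LpTree V p₂ := Sum.elim
    (fun jk => if jk.2 < N jk.1 then lpRestrict {x | b x = jk.1} (f jk.2) else 0)
    fun x => lp.single p₂ x 1
  let Fn : (ℕ × ℕ) ⊕ V → Boundary G o × Spectrum q → ℂ := Sum.elim H fun x p =>
    conj (S x p) - ∑ k ∈ Finset.range (N (b x)), conj (f k x) * H (b x, k) p
  have hH : ∀ jk, IsL1Transform q (fun y => conj (g' jk y)) (H jk) := fun jk => by
    refine isL1Transform_helgason hq hG hreg ((T jk.1).finite_toSet.subset fun y hy => ?_)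
    by_contra hyT
    apply hy
    simp only [g', lpRestrict_apply]
    rw [Set.indicator_of_notMem hyT, map_zero]
  have hFn : ∀ i, IsL1Transform q (fun y => conj (gn i y)) (Fn i) := by
    rintro (jk | x)
    · exact hH jk
    · have h1 := (hKtransform x).sub hq hG (IsL1Transform.finsetSum (Finset.range (N (b x))) hq hG
        fun k _ => (hH (b x, k)).const_mul (conj (f k x)))
      have h2 : ∀ y, (R x : V → ℂ) y = K x y - ∑ k ∈ Finset.range (N (b x)), f k x * g' (b x, k) y := by
        intro y
        simp only [R]
        rw [lp.coeFn_sub, Pi.sub_apply, lp.coeFn_sum]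
        congr 1
        exact Finset.sum_apply y _ _
      have h3 : (fun y => conj (gn (Sum.inr x) y)) = fun y => conj (K x y) -
          ∑ k ∈ Finset.range (N (b x)), conj (f k x) * conj (g' (b x, k) y) := by
        funext y
        refine (congrArg conj (h2 y)).trans ?_
        rw [map_sub, map_sum]
        simp_rw [map_mul]
      rw [h3]
      exact h1
  have hnuc : Summable fun i => ‖gn i‖ * ‖fn i‖ := by
    refine Summable.sum _ ?_ ?_
    · refine Summable.of_nonneg_of_le (fun jk => mul_nonneg (norm_nonneg _) (norm_nonneg _))
        (fun jk => ?_) hbs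
      refine mul_le_mul (norm_lpRestrict_le hr0 _ _) ?_ (norm_nonneg _) (norm_nonneg _)
      simp only [fn, Sum.elim_inl]
      split_ifs
      · exact le_rfl
      · rw [norm_zero]
        exact norm_nonneg _
    · refine Summable.of_nonneg_of_le (fun x => mul_nonneg (norm_nonneg _) (norm_nonneg _))
        (fun x => ?_) hεsum.summable
      have h1 : ‖fn (Sum.inr x)‖ = 1 := by
        simp only [fn, Sum.elim_inr]
        rw [lp.norm_single (pos_iff_ne_zero.2 hp₂0), norm_one]
      simp only [Function.comp_apply]
      rw [h1, mul_one]
      exact hNT (b x) x rfl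
  -- the finitely many terms that are present at the vertex `x`
  let I : V → Finset ((ℕ × ℕ) ⊕ V) := fun x =>
    Finset.disjSum ({b x} ×ˢ Finset.range (N (b x))) {x}
  have hI : ∀ x, ∀ i ∉ I x, fn i x = 0 := by
    rintro x (⟨j, k⟩ | z) hi
    · simp only [fn, Sum.elim_inl]
      split_ifs with hk
      · rw [lpRestrict_apply, Set.indicator_of_notMem]
        rintro rfl
        exact hi (by simpa [I] using hk)
      · rfl
    · have hz : x ≠ z := by
        rintro rfl
        exact hi (by simp [I])
      exact lp.single_apply_ne p₂ z 1 hz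
  have hfin : ∀ x p, HasSum (fun i => fn i x * conj (Fn i p)) (S x p) := by
    intro x p
    have h1 : HasSum (fun i => fn i x * conj (Fn i p)) (∑ i ∈ I x, fn i x * conj (Fn i p)) :=
      hasSum_sum_of_ne_finset_zero fun i hi => by rw [hI x i hi, zero_mul]
    convert h1 using 1
    simp only [I]
    rw [Finset.sum_disjSum, Finset.sum_product, Finset.sum_singleton, Finset.sum_singleton]
    have h2 : ∀ k ∈ Finset.range (N (b x)),
        fn (Sum.inl (b x, k)) x * conj (Fn (Sum.inl (b x, k)) p) =
          f k x * conj (H (b x, k) p) := by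
      intro k hk
      simp only [fn, Fn, Sum.elim_inl, if_pos (Finset.mem_range.1 hk)]
      rw [lpRestrict_apply, Set.indicator_of_mem (by rfl)]
    rw [Finset.sum_congr rfl h2]
    have h3 : (fn (Sum.inr x) : V → ℂ) x = 1 := lp.single_apply_self p₂ x 1
    rw [h3]
    simp only [Fn, Sum.elim_inr, map_sub, map_sum, map_mul, Complex.conj_conj]
    ring
  obtain ⟨e⟩ := nonempty_equiv_of_countable (α := ℕ) (β := (ℕ × ℕ) ⊕ V)
  refine ⟨gn ∘ e, fn ∘ e, Fn ∘ e, e.summable_iff.2 hnuc, fun k => hFn (e k), fun x => ?_,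
    fun x => Eventually.of_forall fun p => ?_⟩
  · refine (e.summable_iff (f := fun i => ‖fn i x‖ * ∫ p, ‖Fn i p‖ ∂spectralMeasure G o q)).2 ?_
    exact summable_of_ne_finset_zero (s := I x) fun i hi => by rw [hI x i hi, norm_zero, zero_mul]
  · have h1 : HasSum (fun k => (fn ∘ e) k x * conj ((Fn ∘ e) k p)) (S x p) :=
      e.hasSum_iff.2 (hfin x p)
    refine ⟨h1.summable, ?_⟩
    rw [h1.tsum_eq, hSdef, inv_mul_cancel_left₀ (waveMinus_ne_zero hq x p)]

end Regrouping

end HomogeneousTree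

theorem mainTheorem1 {V : Type*} (G : SimpleGraph V) (o : V) (q : ℕ) (hq : 2 ≤ q)
    (hG : G.IsTree) (hreg : ∀ v, (G.neighborSet v).ncard = q + 1)
    (p₁ p₂ p₁' : ℝ≥0∞) [Fact (1 ≤ p₁)] [Fact (1 ≤ p₂)] (hp₁ : p₁ ≠ ⊤) (hp₂ : p₂ ≠ ⊤)
    (hconj : ENNReal.HolderConjugate p₁ p₁')
    (σ : V → HomogeneousTree.Boundary G o → HomogeneousTree.Spectrum q → ℂ)
    (hσ : ∀ x, Measurable
      (fun p : HomogeneousTree.Boundary G o × HomogeneousTree.Spectrum q => σ x p.1 p.2)) :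
    (2 ≤ p₁ → (HomogeneousTree.IsNuclearPseudoDiff q σ p₁ p₂ ↔
      HomogeneousTree.HasL2Decomposition q σ p₁' p₂)) ∧
    (1 < p₁ → (HomogeneousTree.IsNuclearPseudoDiff q σ p₁ p₂ ↔
      HomogeneousTree.HasL1Decomposition q σ p₁' p₂)) ∧
    (HomogeneousTree.HasL1Decomposition q σ p₁' p₂ →
      HomogeneousTree.IsNuclearPseudoDiff q σ p₁ p₂) ∧
    (HomogeneousTree.IsNuclearPseudoDiff q σ p₁ p₂ ↔
      HomogeneousTree.HasWeakDecomposition q σ p₁' p₂) := by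
  have : Fact (1 ≤ p₁') := ⟨ENNReal.HolderConjugate.one_le p₁' p₁⟩
  have hweak : HomogeneousTree.IsNuclearPseudoDiff q σ p₁ p₂ ↔
      HomogeneousTree.HasWeakDecomposition q σ p₁' p₂ :=
    ⟨fun h => h.hasWeakDecomposition hp₁ hconj, fun h => h.isNuclearPseudoDiff hconj⟩
  refine ⟨fun h2 => ?_, fun h1 => ?_, fun h => hweak.2 (h.hasWeakDecomposition hq hG), hweak⟩
  · have hle : p₁' ≤ 2 := by
      have h3 := ENNReal.HolderConjugate.inv_add_inv_eq_one p₁ p₁'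
      have h4 : p₁⁻¹ ≤ 2⁻¹ := ENNReal.inv_le_inv.2 h2
      rw [← ENNReal.inv_le_inv]
      by_contra hlt
      push Not at hlt
      have h5 := ENNReal.add_lt_add_of_le_of_lt (by simpa using (zero_lt_two.trans_le h2).ne') h4 hlt
      rw [h3, ENNReal.inv_two_add_inv_two] at h5
      exact lt_irrefl _ h5
    rw [hweak]
    exact ⟨fun h => h.hasL2Decomposition hq hG hreg hle,
      fun h => (h.hasL1Decomposition hq hG hreg hle).hasWeakDecomposition hq hG⟩
  · have hne : p₁' ≠ ⊤ := (ENNReal.HolderConjugate.ne_top_iff_ne_one p₁' p₁).2 h1.ne'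
    rw [hweak]
    exact ⟨fun h => h.hasL1Decomposition hq hG hreg hne hp₂,
      fun h => h.hasWeakDecomposition hq hG⟩
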